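/- Let $\mathbb F$ be a field with algebraic closure $\overline{\mathbb F}$ and $V$ an $\mathbb F$-vector space of finite positive dimension. A tridiagonal pair on $V$ is a pair of diagonalizable linear maps $A,A^*:V\to V$ whose eigenspaces admit orderings $\{V_i\}_{i=0}^d$ (for $A$) and $\{V_i^*\}_{i=0}^\delta$ (for $A^*$) with $A^*V_i\subseteq V_{i-1}+V_i+V_{i+1}$ and $AV^*_i\subseteq V^*_{i-1}+V^*_i+V^*_{i+1}$ (standard orderings), and such that no subspace other than $0,V$ is invariant under both maps. A tridiagonal system $\Phi=(A;\{E_i\}_{i=0}^d;A^*;\{E_i^*\}_{i=0}^d)$ is such a pair together with standard orderings of the primitive idempotents; it is sharp if $\dim E_0V=1$. Let $\theta_i,\theta_i^*$ be the eigenvalues of $A,A^*$ on $E_iV,E_i^*V$. The group $D_4=\langle *,\downarrow,\Downarrow\rangle$ (with relations $*^2=\downarrow^2=\Downarrow^2=1$, $\Downarrow *=*\downarrow$, $\downarrow *=*\Downarrow$, $\downarrow\Downarrow=\Downarrow\downarrow$) acts on tridiagonal systems: $*$ exchanges $(A;\{E_i\})$ and $(A^*;\{E_i^*\})$, $\downarrow$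 replaces $E^*_i$ by $E^*_{d-i}$, and $\Downarrow$ replaces $E_i$ by $E_{d-i}$. Let $\Phi$ be sharp. For $0\le i\le d$ the map $(A^*-\theta_1^*)\cdots(A^*-\theta_i^*)(A-\theta_{i-1})\cdots(A-\theta_0)$ acts on the line $E_0^*V$ as a scalar $\zeta_i$. A base $\beta\in\mathbb F$ of $\Phi$ is, for $d\ge 3$, the scalar such that $\beta+1$ is the common value of $\frac{\theta_{i-2}-\theta_{i+1}}{\theta_{i-1}-\theta_i}$ and $\frac{\theta^*_{i-2}-\theta^*_{i+1}}{\theta^*_{i-1}-\theta^*_i}$ for $2\le i\le d-1$ (such a scalar exists); for $d\le 2$ it is any nonzero scalar, the same one being used for all relatives of $\Phi$ under $D_4$. The type is I if $\beta\ne\pm2$; II if $\beta=2$, $\operatorname{char}\mathbb F\neq2$; III$^+$ (III$^-$) if $\beta=-2$, $\operatorname{char}\mathbb F\ne2$ and $d$ is even (odd); IV if $\beta=0$, $\operatorname{char}\mathbb F=2$. Then there are scalars $a,b,c,a^*,b^*,c^*$ (in $\overline{\mathbb F}$ for type I, with a fixed $q\in\overline{\mathbb F}$, $q\neq0$, $q^2+q^{-2}=\beta$;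 in $\mathbb F$ otherwise) such that for $0\le i\le d$ * I: $\theta_i=a+bq^{2i-d}+cq^{d-2i}$; * II: $\theta_i=a+b(i-d/2)+ci(d-i)$; * III: $\theta_i=a+b+c(i-d/2)$ for $i$ even, $\theta_i=a-b-c(i-d/2)$ for $i$ odd; * IV: $d=3$ and $\theta_0=a$, $\theta_1=b+c$, $\theta_2=a+c$, $\theta_3=b$; and likewise for $\theta_i^*$ with $a^*,b^*,c^*$. The Drinfel'd polynomial is $P=\sum_{i=0}^d\zeta_i\,p_{i+1}\cdots p_d$ for types other than III$^+$, where $p_i=(\theta_0\theta_d^*+\theta_d\theta_0^*-\lambda)\alpha_i+(\theta_0-\theta_i)(\theta_0^*-\theta_i^*)$ with $\alpha_i=\frac{(q^i-q^{-i})^2}{(q^d-q^{-d})^2}$ (I), $\alpha_i=i^2/d^2$ (II), and $\alpha_i=0$ for $i$ even, $\alpha_i=1$ for $i$ odd (III$^-$, IV). For type III$^+$, $P=p_1\cdots p_d$ with $p_i=(\theta_0\theta_d^*+\theta_d\theta_0^*-\lambda)i^2/d^2+(\theta_0-\theta_i)(\theta_0^*-\theta_i^*)$ for $i$ even and $p_i=\theta_0\theta_d^*+\theta_d\theta_0^*-\lambda$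 for $i$ odd. The normalized Drinfel'd polynomial is $\hat P=P$ for type III$^+$ and $\hat P=\sum_{i=0}^d\zeta_i\,\hat p_{i+1}\cdots\hat p_d$ otherwise, where * I: $\hat p_i=(q^i-q^{-i})^2(bb^*q^{2i-2d}+cc^*q^{2d-2i}-\lambda)$; * II: $\hat p_i=i^2(bb^*/2+(bc^*+cb^*)(d-i)+cc^*(d-i)^2-\lambda)$; * III$^-$: $\hat p_i=cc^*i^2$ for $i$ even, $\hat p_i=2bb^*+2(bc^*+cb^*)(i-d)+cc^*(i-d)^2-\lambda$ for $i$ odd; * IV: $\hat p_1=ab^*+ba^*+(a+b+c)(a^*+b^*+c^*)+\lambda$, $\hat p_2=cc^*$, $\hat p_3=ab^*+ba^*+(a+b)(a^*+b^*)+\lambda$. Theorem. For every sharp tridiagonal system $\Phi$, the objects above exist; $\hat P(\lambda)=P(u\lambda+v)$, where $u=(q^d-q^{-d})^2$, $v=2aa^*+2(b+c)(b^*+c^*)+(q^d+q^{-d})(a(b^*+c^*)+a^*(b+c))$ for type I; $u=d^2$, $v=2aa^*$ for type II; $u=1$, $v=(2a-cd)(2a^*-c^*d)/2$ for type III$^-$;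 $u=1$, $v=0$ for types III$^+$ and IV; and $\hat P$ is $D_4$-invariant: for every $g\in D_4$, the normalized Drinfel'd polynomials of $\Phi$ and of its relative under $g$ coincide, whatever scalars $q,a,b,c,a^*,b^*,c^*$ are used for each of the two systems, except that for type I with $d=1$ (where these scalars are not unique) the scalars of the relative are those obtained from the scalars of $\Phi$ by the corresponding action of $D_4$ with $q$ fixed: $*$ exchanges $(a,b,c)$ and $(a^*,b^*,c^*)$, $\downarrow$ exchanges $b^*$ and $c^*$, and $\Downarrow$ exchanges $b$ and $c$. (For type I, these transported scalars are always valid scalars for the relative.) -/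

import Mathlib

open Polynomial

/-! ### Tridiagonal pairs -/

section Pairs

variable {F V : Type*} [Field F] [AddCommGroup V] [Module F V]

/-- `A` is diagonalizable: `V` is spanned by the eigenspaces of `A`. -/
def IsDiagonalizableEnd (A : Module.End F V) : Prop :=
  ⨆ θ : F, A.eigenspace θ = ⊤

/-- `W 0, …, W d` is an ordering of the (nonzero) eigenspaces of `A`. -/
def IsEigenspaceOrdering (A : Module.End F V) {d : ℕ} (W : Fin (d + 1) → Submodule F V) : Prop :=
  Function.Injective W ∧ Set.range W = {U | U ≠ ⊥ ∧ ∃ θ : F, U = A.eigenspace θ}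

/-- `W 0, …, W d` is a standard ordering of the eigenspaces of `A` (relative to `B`):
`B (W i) ⊆ W (i-1) + W i + W (i+1)`, where `W (-1) = W (d+1) = 0`. -/
def IsStandardOrdering (A B : Module.End F V) {d : ℕ} (W : Fin (d + 1) → Submodule F V) : Prop :=
  IsEigenspaceOrdering A W ∧
    ∀ i, (W i).map B ≤ ⨆ j : Fin (d + 1), ⨆ _ : (j : ℕ) ≤ i + 1 ∧ (i : ℕ) ≤ j + 1, W j

/-- The pair `A, As` is a tridiagonal pair on `V`. -/
structure IsTridiagonalPair (A As : Module.End F V) : Prop where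
  diag : IsDiagonalizableEnd A
  diag_dual : IsDiagonalizableEnd As
  standard : ∃ (d : ℕ) (W : Fin (d + 1) → Submodule F V), IsStandardOrdering A As W
  standard_dual : ∃ (d : ℕ) (W : Fin (d + 1) → Submodule F V), IsStandardOrdering As A W
  irreducible : ¬ ∃ W : Submodule F V, W.map A ≤ W ∧ W.map As ≤ W ∧ W ≠ ⊥ ∧ W ≠ ⊤

/-- `E 0, …, E d` is a standard ordering of the primitive idempotents of `A` (relative to `B`):
for a standard ordering `W` of the eigenspaces of `A`, each `E i` is the identity on `W i` and
zero on `W j` for `j ≠ i`. -/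
def IsStandardIdempotents (A B : Module.End F V) {d : ℕ} (E : Fin (d + 1) → Module.End F V) :
    Prop :=
  ∃ W : Fin (d + 1) → Submodule F V, IsStandardOrdering A B W ∧
    ∀ i, (∀ v ∈ W i, E i v = v) ∧ ∀ j, j ≠ i → ∀ v ∈ W j, E i v = 0

theorem IsTridiagonalPair.swap {A As : Module.End F V} (h : IsTridiagonalPair A As) :
    IsTridiagonalPair As A :=
  ⟨h.diag_dual, h.diag, h.standard_dual, h.standard,
    fun ⟨W, h1, h2, h3⟩ => h.irreducible ⟨W, h2, h1, h3⟩⟩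

theorem IsStandardOrdering.rev {A B : Module.End F V} {d : ℕ} {W : Fin (d + 1) → Submodule F V}
    (h : IsStandardOrdering A B W) : IsStandardOrdering A B (fun i => W i.rev) := by
  obtain ⟨⟨hinj, hrange⟩, hmap⟩ := h
  refine ⟨⟨hinj.comp Fin.rev_injective, ?_⟩, fun i => (hmap i.rev).trans ?_⟩
  · rw [← hrange]
    exact Fin.rev_surjective.range_comp W
  · refine iSup_le fun j => iSup_le fun hj => ?_
    have hle : (j.rev : ℕ) ≤ i + 1 ∧ (i : ℕ) ≤ j.rev + 1 := by
      simp only [Fin.val_rev] at hj ⊢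
      omega
    refine le_trans ?_ (le_iSup₂_of_le j.rev hle le_rfl)
    simp

theorem IsStandardIdempotents.rev {A B : Module.End F V} {d : ℕ}
    {E : Fin (d + 1) → Module.End F V} (h : IsStandardIdempotents A B E) :
    IsStandardIdempotents A B (fun i => E i.rev) := by
  obtain ⟨W, hW, hE⟩ := h
  exact ⟨fun i => W i.rev, hW.rev, fun i => ⟨(hE i.rev).1,
    fun j hj => (hE i.rev).2 j.rev fun hh => hj (Fin.rev_injective hh)⟩⟩

/-- The image of a primitive idempotent of a diagonalizable map is an eigenspace. -/
theorem IsStandardIdempotents.exists_eigenvalue {A B : Module.End F V} {d : ℕ}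
    {E : Fin (d + 1) → Module.End F V} (h : IsStandardIdempotents A B E)
    (hA : IsDiagonalizableEnd A) (i : Fin (d + 1)) :
    ∃ θ : F, LinearMap.range (E i) = A.eigenspace θ := by
  obtain ⟨W, ⟨⟨_, hrange⟩, _⟩, hE⟩ := h
  obtain ⟨_, θ, hθ⟩ : W i ∈ {U | U ≠ ⊥ ∧ ∃ θ : F, U = A.eigenspace θ} :=
    hrange ▸ Set.mem_range_self i
  refine ⟨θ, ?_⟩
  rw [← hθ]
  apply le_antisymm
  · rw [LinearMap.range_eq_map, ← hA, Submodule.map_iSup]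
    refine iSup_le fun μ => ?_
    rintro _ ⟨v, hv, rfl⟩
    by_cases hbot : A.eigenspace μ = ⊥
    · have : v = 0 := by simpa [hbot] using hv
      simp [this]
    · obtain ⟨j, hj⟩ : A.eigenspace μ ∈ Set.range W := hrange ▸ ⟨hbot, μ, rfl⟩
      have hv' : v ∈ W j := hj ▸ hv
      by_cases hji : j = i
      · subst hji
        rw [(hE j).1 v hv']
        exact hv'
      · rw [(hE i).2 j hji v hv']
        exact zero_mem _
  · exact fun v hv => ⟨v, (hE i).1 v hv⟩

end Pairs

/-! ### Tridiagonal systems -/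

/-- A tridiagonal system `(A; E₀,…,E_d; A*; E*₀,…,E*_d)` of diameter `d` on `V`. -/
@[ext]
structure TridiagonalSystem (F V : Type*) [Field F] [AddCommGroup V] [Module F V] (d : ℕ) where
  A : Module.End F V
  E : Fin (d + 1) → Module.End F V
  As : Module.End F V
  Es : Fin (d + 1) → Module.End F V
  isPair : IsTridiagonalPair A As
  standard : IsStandardIdempotents A As E
  standard_dual : IsStandardIdempotents As A Es

namespace TridiagonalSystem

variable {F V : Type*} [Field F] [AddCommGroup V] [Module F V] {d : ℕ}

/-- `Φ ↦ Φ^*`. -/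
def star (Φ : TridiagonalSystem F V d) : TridiagonalSystem F V d :=
  ⟨Φ.As, Φ.Es, Φ.A, Φ.E, Φ.isPair.swap, Φ.standard_dual, Φ.standard⟩

/-- `Φ ↦ Φ^↓`, which reverses the ordering of the `E*ᵢ`. -/
def down (Φ : TridiagonalSystem F V d) : TridiagonalSystem F V d :=
  ⟨Φ.A, Φ.E, Φ.As, fun i => Φ.Es i.rev, Φ.isPair, Φ.standard, Φ.standard_dual.rev⟩

/-- `Φ ↦ Φ^⇓`, which reverses the ordering of the `Eᵢ`. -/
def ddown (Φ : TridiagonalSystem F V d) : TridiagonalSystem F V d :=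
  ⟨Φ.A, fun i => Φ.E i.rev, Φ.As, Φ.Es, Φ.isPair, Φ.standard.rev, Φ.standard_dual⟩

theorem star_star (Φ : TridiagonalSystem F V d) : Φ.star.star = Φ := rfl

theorem down_down (Φ : TridiagonalSystem F V d) : Φ.down.down = Φ := by
  ext1 <;> simp [down]

theorem ddown_ddown (Φ : TridiagonalSystem F V d) : Φ.ddown.ddown = Φ := by
  ext1 <;> simp [ddown]

/-- `Φ` is sharp: `dim E₀V = 1`. -/
def IsSharp (Φ : TridiagonalSystem F V d) : Prop :=
  Module.finrank F (LinearMap.range (Φ.E 0)) = 1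

/-- `θᵢ`, the eigenvalue of `A` associated with `EᵢV` (and `0` for `i > d`). -/
noncomputable def theta (Φ : TridiagonalSystem F V d) (i : ℕ) : F :=
  if h : i < d + 1 then
    (Φ.standard.exists_eigenvalue Φ.isPair.diag ⟨i, h⟩).choose
  else 0

/-- `θ*ᵢ`, the eigenvalue of `A*` associated with `E*ᵢV` (and `0` for `i > d`). -/
noncomputable def thetas (Φ : TridiagonalSystem F V d) (i : ℕ) : F :=
  Φ.star.theta i

/-- The map `(A* - θ*₁)(A* - θ*₂)⋯(A* - θ*ᵢ)(A - θ_{i-1})⋯(A - θ₁)(A - θ₀)`. -/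
noncomputable def splitMap (Φ : TridiagonalSystem F V d) (i : ℕ) : Module.End F V :=
  aeval Φ.As (∏ h ∈ Finset.range i, (X - C (Φ.thetas (h + 1)))) *
    aeval Φ.A (∏ h ∈ Finset.range i, (X - C (Φ.theta h)))

/-- `z` is the eigenvalue of the `i`-th split map on the space `U₀ = E*₀V`. -/
def IsSplitValue (Φ : TridiagonalSystem F V d) (i : ℕ) (z : F) : Prop :=
  ∀ v ∈ LinearMap.range (Φ.Es 0), Φ.splitMap i v = z • v

open Classical in
/-- The split sequence `ζᵢ` of a sharp tridiagonal system. -/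
noncomputable def zeta (Φ : TridiagonalSystem F V d) (i : ℕ) : F :=
  if h : ∃ z : F, Φ.IsSplitValue i z then h.choose else 0

/-- `β` is a base of `Φ`: for `d ≥ 3`, `β + 1` is the common value of the two ratios for
`2 ≤ i ≤ d - 1`; for `d ≤ 2`, `β` is any nonzero scalar. -/
def IsBase (Φ : TridiagonalSystem F V d) (β : F) : Prop :=
  if 3 ≤ d then
    ∀ i : ℕ, 2 ≤ i → i ≤ d - 1 →
      (Φ.theta (i - 2) - Φ.theta (i + 1)) / (Φ.theta (i - 1) - Φ.theta i) = β + 1 ∧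
      (Φ.thetas (i - 2) - Φ.thetas (i + 1)) / (Φ.thetas (i - 1) - Φ.thetas i) = β + 1
  else β ≠ 0

/-- `θᵢ` as an element of the algebraic closure. -/
noncomputable def thetaBar (Φ : TridiagonalSystem F V d) (i : ℕ) : AlgebraicClosure F :=
  algebraMap F (AlgebraicClosure F) (Φ.theta i)

/-- `θ*ᵢ` as an element of the algebraic closure. -/
noncomputable def thetasBar (Φ : TridiagonalSystem F V d) (i : ℕ) : AlgebraicClosure F :=
  algebraMap F (AlgebraicClosure F) (Φ.thetas i)

/-- `ζᵢ` as an element of the algebraic closure. -/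
noncomputable def zetaBar (Φ : TridiagonalSystem F V d) (i : ℕ) : AlgebraicClosure F :=
  algebraMap F (AlgebraicClosure F) (Φ.zeta i)

end TridiagonalSystem

/-! ### Types -/

/-- The five types of tridiagonal systems. -/
inductive TDType
  | I | II | IIIplus | IIIminus | IV

open Classical in
/-- The type attached to a base `β` and a diameter `d`. In characteristic `2` one has
`2 = -2 = 0`, so the last case is `β = 0`, `Char F = 2`. -/
noncomputable def tdType {F : Type*} [Field F] (β : F) (d : ℕ) : TDType :=
  if β ≠ 2 ∧ β ≠ -2 then TDType.I
  else if ringChar F ≠ 2 then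
    if β = 2 then TDType.II
    else if Even d then TDType.IIIplus else TDType.IIIminus
  else TDType.IV

/-! ### The auxiliary scalars `q, a, b, c, a*, b*, c*` -/

/-- Scalars `q, a, b, c, a*, b*, c*` in a field `K`; `q` is used for type I only. -/
@[ext]
structure TDScalars (K : Type*) where
  q : K
  a : K
  b : K
  c : K
  as : K
  bs : K
  cs : K

namespace TDScalars

variable {K : Type*}

/-- The scalars for `Φ^*` obtained from those for `Φ` (type I). -/
def star (e : TDScalars K) : TDScalars K := ⟨e.q, e.as, e.bs, e.cs, e.a, e.b, e.c⟩

/-- The scalars for `Φ^↓` obtained from those for `Φ` (type I). -/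
def down (e : TDScalars K) : TDScalars K := ⟨e.q, e.a, e.b, e.c, e.as, e.cs, e.bs⟩

/-- The scalars for `Φ^⇓` obtained from those for `Φ` (type I). -/
def ddown (e : TDScalars K) : TDScalars K := ⟨e.q, e.a, e.c, e.b, e.as, e.bs, e.cs⟩

end TDScalars

/-! ### The group `D₄` and its actions -/

/-- The generators `*`, `↓`, `⇓` of `D₄`. -/
inductive D4Gen
  | star | down | ddown

/-- The defining relations of `D₄`: `*² = ↓² = ⇓² = 1`, `⇓* = *↓`, `↓* = *⇓`, `↓⇓ = ⇓↓`. -/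
def D4Rels : Set (FreeGroup D4Gen) :=
  let s := FreeGroup.of D4Gen.star
  let r := FreeGroup.of D4Gen.down
  let t := FreeGroup.of D4Gen.ddown
  {s * s, r * r, t * t, t * s * (s * r)⁻¹, r * s * (s * t)⁻¹, r * t * (t * r)⁻¹}

/-- The dihedral group `D₄`, by generators and relations. -/
abbrev D4 : Type := PresentedGroup D4Rels

/-- The permutations of the set of tridiagonal systems given by the generators. -/
def TridiagonalSystem.genPerm {F V : Type*} [Field F] [AddCommGroup V] [Module F V] {d : ℕ} :
    D4Gen → Equiv.Perm (TridiagonalSystem F V d)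
  | .star => Function.Involutive.toPerm _ TridiagonalSystem.star_star
  | .down => Function.Involutive.toPerm _ TridiagonalSystem.down_down
  | .ddown => Function.Involutive.toPerm _ TridiagonalSystem.ddown_ddown

/-- The permutations of the set of scalars given by the generators. -/
def TDScalars.genPerm {K : Type*} : D4Gen → Equiv.Perm (TDScalars K)
  | .star => Function.Involutive.toPerm TDScalars.star fun _ => rfl
  | .down => Function.Involutive.toPerm TDScalars.down fun _ => rfl
  | .ddown => Function.Involutive.toPerm TDScalars.ddown fun _ => rfl

theorem TridiagonalSystem.genPerm_rels {F V : Type*} [Field F] [AddCommGroup V] [Module F V]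
    {d : ℕ} : ∀ r ∈ D4Rels, FreeGroup.lift
      (TridiagonalSystem.genPerm (F := F) (V := V) (d := d)) r = 1 := by
  intro r hr
  simp only [D4Rels, Set.mem_insert_iff, Set.mem_singleton_iff] at hr
  rcases hr with rfl | rfl | rfl | rfl | rfl | rfl
  · rw [map_mul]; simp only [FreeGroup.lift_apply_of]; ext1 Φ; exact star_star Φ
  · rw [map_mul]; simp only [FreeGroup.lift_apply_of]; ext1 Φ; exact down_down Φ
  · rw [map_mul]; simp only [FreeGroup.lift_apply_of]; ext1 Φ; exact ddown_ddown Φ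
  all_goals
    rw [map_mul, map_inv, mul_inv_eq_one, map_mul, map_mul]
    simp only [FreeGroup.lift_apply_of]
    ext1 Φ
    rfl

theorem TDScalars.genPerm_rels {K : Type*} : ∀ r ∈ D4Rels, FreeGroup.lift
    (TDScalars.genPerm (K := K)) r = 1 := by
  intro r hr
  simp only [D4Rels, Set.mem_insert_iff, Set.mem_singleton_iff] at hr
  rcases hr with rfl | rfl | rfl | rfl | rfl | rfl
  · rw [map_mul]; simp only [FreeGroup.lift_apply_of]; ext1 e; rfl
  · rw [map_mul]; simp only [FreeGroup.lift_apply_of]; ext1 e; rfl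
  · rw [map_mul]; simp only [FreeGroup.lift_apply_of]; ext1 e; rfl
  all_goals
    rw [map_mul, map_inv, mul_inv_eq_one, map_mul, map_mul]
    simp only [FreeGroup.lift_apply_of]
    ext1 e
    rfl

/-- The action of `D₄` on tridiagonal systems, written on the left: `d4 g Φ = Φ^{g⁻¹}`. -/
def TridiagonalSystem.d4 {F V : Type*} [Field F] [AddCommGroup V] [Module F V] {d : ℕ} :
    D4 →* Equiv.Perm (TridiagonalSystem F V d) :=
  PresentedGroup.toGroup TridiagonalSystem.genPerm_rels

/-- The corresponding action of `D₄` on scalars (used for type I only). -/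
def TDScalars.d4 {K : Type*} : D4 →* Equiv.Perm (TDScalars K) :=
  PresentedGroup.toGroup TDScalars.genPerm_rels

namespace TridiagonalSystem

variable {F V : Type*} [Field F] [AddCommGroup V] [Module F V] {d : ℕ}

/-- The six scalars `a, b, c, a*, b*, c*` belong to `F`. -/
def _root_.TDScalars.IsRational (e : TDScalars (AlgebraicClosure F)) : Prop :=
  ∀ x ∈ [e.a, e.b, e.c, e.as, e.bs, e.cs], x ∈ (algebraMap F (AlgebraicClosure F)).range

/-- `e` is a system of scalars expressing the eigenvalue and dual eigenvalue sequences of `Φ`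
in closed form, according to the type given by the base `β`. -/
def IsScalars (Φ : TridiagonalSystem F V d) (β : F) (e : TDScalars (AlgebraicClosure F)) : Prop :=
  match tdType β d with
  | .I =>
      e.q ≠ 0 ∧ e.q ^ 2 + (e.q⁻¹) ^ 2 = algebraMap F (AlgebraicClosure F) β ∧
      ∀ i : ℕ, i ≤ d →
        Φ.thetaBar i =
          e.a + e.b * e.q ^ (2 * (i : ℤ) - d) + e.c * e.q ^ ((d : ℤ) - 2 * i) ∧
        Φ.thetasBar i =
          e.as + e.bs * e.q ^ (2 * (i : ℤ) - d) + e.cs * e.q ^ ((d : ℤ) - 2 * i)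
  | .II =>
      e.IsRational ∧
      ∀ i : ℕ, i ≤ d →
        Φ.thetaBar i = e.a + e.b * ((i : AlgebraicClosure F) - d / 2) + e.c * i * (d - i) ∧
        Φ.thetasBar i = e.as + e.bs * ((i : AlgebraicClosure F) - d / 2) + e.cs * i * (d - i)
  | .IIIplus | .IIIminus =>
      e.IsRational ∧
      ∀ i : ℕ, i ≤ d →
        (Φ.thetaBar i = if Even i then e.a + e.b + e.c * ((i : AlgebraicClosure F) - d / 2)
          else e.a - e.b - e.c * ((i : AlgebraicClosure F) - d / 2)) ∧
        (Φ.thetasBar i = if Even i then e.as + e.bs + e.cs * ((i : AlgebraicClosure F) - d / 2)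
          else e.as - e.bs - e.cs * ((i : AlgebraicClosure F) - d / 2))
  | .IV =>
      d = 3 ∧ e.IsRational ∧
      (Φ.thetaBar 0 = e.a ∧ Φ.thetaBar 1 = e.b + e.c ∧
        Φ.thetaBar 2 = e.a + e.c ∧ Φ.thetaBar 3 = e.b) ∧
      (Φ.thetasBar 0 = e.as ∧ Φ.thetasBar 1 = e.bs + e.cs ∧
        Φ.thetasBar 2 = e.as + e.cs ∧ Φ.thetasBar 3 = e.bs)

/-! ### The Drinfel'd polynomial `P` -/

/-- The scalar `αᵢ`. For type III⁺ this is `i²/d²` for even `i` and `1` for odd `i`. -/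
noncomputable def alpha (β : F) (d : ℕ) (q : AlgebraicClosure F) (i : ℕ) : AlgebraicClosure F :=
  match tdType β d with
  | .I => (q ^ i - (q⁻¹) ^ i) ^ 2 / (q ^ d - (q⁻¹) ^ d) ^ 2
  | .II => (i : AlgebraicClosure F) ^ 2 / (d : AlgebraicClosure F) ^ 2
  | .IIIplus => if Even i then (i : AlgebraicClosure F) ^ 2 / (d : AlgebraicClosure F) ^ 2 else 1
  | .IIIminus | .IV => if Even i then 0 else 1

/-- The polynomial `pᵢ`. For type III⁺ and `i` odd the constant summand is absent. -/
noncomputable def p (Φ : TridiagonalSystem F V d) (β : F) (q : AlgebraicClosure F) (i : ℕ) :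
    (AlgebraicClosure F)[X] :=
  let main : (AlgebraicClosure F)[X] :=
    (C (Φ.thetaBar 0 * Φ.thetasBar d + Φ.thetaBar d * Φ.thetasBar 0) - X) * C (alpha β d q i)
  let const : (AlgebraicClosure F)[X] :=
    C ((Φ.thetaBar 0 - Φ.thetaBar i) * (Φ.thetasBar 0 - Φ.thetasBar i))
  match tdType β d with
  | .IIIplus => if Even i then main + const else main
  | _ => main + const

/-- The Drinfel'd polynomial `P` of `Φ`. -/
noncomputable def drinfeld (Φ : TridiagonalSystem F V d) (β : F) (q : AlgebraicClosure F) :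
    (AlgebraicClosure F)[X] :=
  match tdType β d with
  | .IIIplus => ∏ i ∈ Finset.Icc 1 d, Φ.p β q i
  | _ => ∑ i ∈ Finset.range (d + 1), C (Φ.zetaBar i) * ∏ j ∈ Finset.Icc (i + 1) d, Φ.p β q j

/-! ### The normalized Drinfel'd polynomial -/

/-- The polynomial `p̂ᵢ` (not used for type III⁺). -/
noncomputable def _root_.TDScalars.hatp (β : F) (d : ℕ) (e : TDScalars (AlgebraicClosure F))
    (i : ℕ) : (AlgebraicClosure F)[X] :=
  match tdType β d with
  | .I =>
      C ((e.q ^ i - (e.q⁻¹) ^ i) ^ 2) *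
        (C (e.b * e.bs * e.q ^ (2 * (i : ℤ) - 2 * d) + e.c * e.cs * e.q ^ (2 * (d : ℤ) - 2 * i))
          - X)
  | .II =>
      C ((i : AlgebraicClosure F) ^ 2) *
        (C (e.b * e.bs / 2 + (e.b * e.cs + e.c * e.bs) * ((d : AlgebraicClosure F) - i)
          + e.c * e.cs * ((d : AlgebraicClosure F) - i) ^ 2) - X)
  | .IIIplus => 0
  | .IIIminus =>
      if Even i then C (e.c * e.cs * (i : AlgebraicClosure F) ^ 2)
      else
        C (2 * e.b * e.bs + 2 * (e.b * e.cs + e.c * e.bs) * ((i : AlgebraicClosure F) - d)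
          + e.c * e.cs * ((i : AlgebraicClosure F) - d) ^ 2) - X
  | .IV =>
      if i = 1 then
        C (e.a * e.bs + e.b * e.as + (e.a + e.b + e.c) * (e.as + e.bs + e.cs)) + X
      else if i = 2 then C (e.c * e.cs)
      else C (e.a * e.bs + e.b * e.as + (e.a + e.b) * (e.as + e.bs)) + X

/-- The normalized Drinfel'd polynomial `P̂` of `Φ`, computed with the scalars `e`. -/
noncomputable def normalizedDrinfeld (Φ : TridiagonalSystem F V d) (β : F)
    (e : TDScalars (AlgebraicClosure F)) : (AlgebraicClosure F)[X] :=
  match tdType β d with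
  | .IIIplus => Φ.drinfeld β e.q
  | _ => ∑ i ∈ Finset.range (d + 1), C (Φ.zetaBar i) * ∏ j ∈ Finset.Icc (i + 1) d, e.hatp β d j

/-- The scalar `u` in `P̂(λ) = P(uλ + v)`. -/
noncomputable def _root_.TDScalars.u (β : F) (d : ℕ) (e : TDScalars (AlgebraicClosure F)) :
    AlgebraicClosure F :=
  match tdType β d with
  | .I => (e.q ^ d - (e.q⁻¹) ^ d) ^ 2
  | .II => (d : AlgebraicClosure F) ^ 2
  | .IIIplus | .IIIminus | .IV => 1

/-- The scalar `v` in `P̂(λ) = P(uλ + v)`. -/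
noncomputable def _root_.TDScalars.v (β : F) (d : ℕ) (e : TDScalars (AlgebraicClosure F)) :
    AlgebraicClosure F :=
  match tdType β d with
  | .I =>
      2 * e.a * e.as + 2 * (e.b + e.c) * (e.bs + e.cs)
        + (e.q ^ d + (e.q⁻¹) ^ d) * e.a * (e.bs + e.cs)
        + (e.q ^ d + (e.q⁻¹) ^ d) * e.as * (e.b + e.c)
  | .II => 2 * e.a * e.as
  | .IIIminus => (2 * e.a - e.c * d) * (2 * e.as - e.cs * d) / 2
  | .IIIplus | .IV => 0

end TridiagonalSystem

/-! Outside type III⁺ the polynomial `P̂` is a sum over the split sequence, and two symmetries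
suffice, since `↓ = *⇓*`. For `*`, each `p̂ᵢ` is visibly symmetric and `ζᵢ(Φ^*) = ζᵢ(Φ)`
(`IsSharp.zeta_star`). The latter compares the two flags `E*₀V + ⋯ + E*_{n-1}V` and `E_nV + ⋯ +
E_dV`, which meet in `0` by irreducibility (`low_inf_up`).

For `⇓`, let `μ_m` be the scalar by which `E*₀E_m` acts on the line `E*₀V`. Then `ζᵢ = φᵢ ∑_m μ_m
∏_{h<i} (θ_m - θ_h)` with `φᵢ = ∏_{h=1}^{i} (θ*₀ - θ*_h)`, while `ζᵢ(Φ^⇓)` has the same `φᵢ` and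
`μ_m` but the nodes `θ_{d-h}` (`IsSharp.exists_moments`). It is therefore enough to compare the
coefficients of each `μ_m`. These are two Newton interpolation formulas, over the nodes in the given
and in the reversed order, evaluated at `θ_m`. They agree because `φᵢ p̂_{i+1}⋯p̂_d` and its
counterpart for `Φ^⇓` are two edges of one triangular table of divided differences, with explicit
product entries (`newton_sum_rev`). The recurrence of that table reduces to an identity between the
closed forms of the eigenvalues, checked type by type (`IsScalars.hatr_sub`).

For type III⁺ the polynomial is a product over `1, …, d` in which `⇓` interchanges the linear
factors at even and at odd indices; as `d` is even there are equally many of each.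

The base comes from a relation `A²A*A - AA*A² = z(A)A* - A*z(A)`: the action on the flags forces
`deg z ≤ 3`, and both recurrences are then read off from the coefficients of `z`. Closed forms are
the solutions of that recurrence. The substitution `P̂(λ) = P(uλ + v)` holds factor by factor, and
the scalars enter `p̂ᵢ` only through combinations determined by the eigenvalues, except for type I
with `d = 1`. -/

section Idempotents

variable {F V : Type*} [Field F] [AddCommGroup V] [Module F V] {d : ℕ}

/-- Linear maps that agree on all members of an ordering of the eigenspaces are equal. -/
theorem IsEigenspaceOrdering.hom_ext {A : Module.End F V} {W : Fin (d + 1) → Submodule F V}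
    (hW : IsEigenspaceOrdering A W) (hA : IsDiagonalizableEnd A) {f g : Module.End F V}
    (h : ∀ i, ∀ v ∈ W i, f v = g v) : f = g := by
  have key : (⊤ : Submodule F V) ≤ LinearMap.eqLocus f g := by
    rw [← hA]
    refine iSup_le fun μ v hv => ?_
    by_cases hbot : A.eigenspace μ = ⊥
    · have : v = 0 := by simpa [hbot] using hv
      simp [this]
    · obtain ⟨j, hj⟩ : A.eigenspace μ ∈ Set.range W := hW.2 ▸ ⟨hbot, μ, rfl⟩
      exact h j v (hj ▸ hv)
  ext v
  exact key (Submodule.mem_top : v ∈ ⊤)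

end Idempotents

/-! ### Primitive idempotents and eigenvalues. -/

namespace TridiagonalSystem

variable {F V : Type*} [Field F] [AddCommGroup V] [Module F V] {d : ℕ}
  (Φ : TridiagonalSystem F V d)

theorem range_E (i : Fin (d + 1)) : LinearMap.range (Φ.E i) = Φ.A.eigenspace (Φ.theta i) := by
  have h : (i : ℕ) < d + 1 := i.2
  simp only [theta, h, dif_pos]
  exact (Φ.standard.exists_eigenvalue Φ.isPair.diag i).choose_spec

theorem exists_ordering : ∃ W : Fin (d + 1) → Submodule F V, IsStandardOrdering Φ.A Φ.As W ∧
    (∀ i, ∀ v ∈ W i, Φ.E i v = v) ∧ (∀ i j, j ≠ i → ∀ v ∈ W j, Φ.E i v = 0) ∧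
    (∀ i, LinearMap.range (Φ.E i) = W i) := by
  obtain ⟨W, hW, hE⟩ := Φ.standard
  refine ⟨W, hW, fun i => (hE i).1, fun i => (hE i).2, fun i => le_antisymm ?_ ?_⟩
  · have hker : (⊤ : Submodule F V) ≤ (W i).comap (Φ.E i) := by
      rw [← Φ.isPair.diag]
      refine iSup_le fun μ v hv => ?_
      by_cases hbot : Φ.A.eigenspace μ = ⊥
      · have : v = 0 := by simpa [hbot] using hv
        simp [this]
      · obtain ⟨j, hj⟩ : Φ.A.eigenspace μ ∈ Set.range W := hW.1.2 ▸ ⟨hbot, μ, rfl⟩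
        have hv' : v ∈ W j := hj ▸ hv
        by_cases hji : j = i
        · subst hji
          simpa [(hE j).1 v hv'] using hv'
        · simp [(hE i).2 j hji v hv']
    rintro _ ⟨v, rfl⟩
    exact hker (Submodule.mem_top : v ∈ ⊤)
  · exact fun v hv => ⟨v, (hE i).1 v hv⟩

theorem A_mul_E (i : Fin (d + 1)) : Φ.A * Φ.E i = Φ.theta i • Φ.E i := by
  ext v
  have : Φ.E i v ∈ Φ.A.eigenspace (Φ.theta i) := Φ.range_E i ▸ LinearMap.mem_range_self _ v
  simpa using Module.End.mem_eigenspace_iff.1 this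

theorem E_mul_E_self (i : Fin (d + 1)) : Φ.E i * Φ.E i = Φ.E i := by
  obtain ⟨W, hW, h1, -, h3⟩ := Φ.exists_ordering
  ext v
  exact h1 i _ (h3 i ▸ LinearMap.mem_range_self _ v)

theorem E_mul_E_ne {i j : Fin (d + 1)} (h : i ≠ j) : Φ.E i * Φ.E j = 0 := by
  obtain ⟨W, hW, -, h2, h3⟩ := Φ.exists_ordering
  ext v
  exact h2 i j h.symm _ (h3 j ▸ LinearMap.mem_range_self _ v)

theorem sum_E : ∑ i, Φ.E i = 1 := by
  obtain ⟨W, hW, h1, h2, h3⟩ := Φ.exists_ordering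
  refine hW.1.hom_ext Φ.isPair.diag fun i v hv => ?_
  rw [LinearMap.sum_apply, Finset.sum_eq_single i]
  · simpa using h1 i v hv
  · exact fun j _ hj => h2 j i hj.symm v hv
  · simp

theorem sum_E_apply (v : V) : ∑ i, Φ.E i v = v := by
  rw [← LinearMap.sum_apply, Φ.sum_E]
  rfl

theorem E_mul_A (i : Fin (d + 1)) : Φ.E i * Φ.A = Φ.theta i • Φ.E i := by
  have h : Φ.A = ∑ j : Fin (d + 1), Φ.theta j • Φ.E j := by
    rw [← mul_one Φ.A, ← Φ.sum_E, Finset.mul_sum]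
    exact Finset.sum_congr rfl fun j _ => Φ.A_mul_E j
  rw [h, Finset.mul_sum, Finset.sum_eq_single i]
  · rw [mul_smul_comm, Φ.E_mul_E_self]
  · intro j _ hj
    rw [mul_smul_comm, Φ.E_mul_E_ne hj.symm, smul_zero]
  · simp

theorem E_mul_As_mul_E {i j : Fin (d + 1)} (h : (i : ℕ) + 1 < j ∨ (j : ℕ) + 1 < i) :
    Φ.E i * Φ.As * Φ.E j = 0 := by
  obtain ⟨W, hW, -, h2, h3⟩ := Φ.exists_ordering
  have hle : (W j).map Φ.As ≤ LinearMap.ker (Φ.E i) := by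
    refine (hW.2 j).trans (iSup₂_le fun k hk v hv => ?_)
    refine h2 i k (fun hki => ?_) v hv
    subst hki
    omega
  ext v
  have : Φ.E j v ∈ W j := h3 j ▸ LinearMap.mem_range_self _ v
  exact hle ⟨_, this, rfl⟩

theorem E_ne_zero (i : Fin (d + 1)) : Φ.E i ≠ 0 := by
  obtain ⟨W, hW, -, -, h3⟩ := Φ.exists_ordering
  intro h
  have h4 : W i ∈ {U | U ≠ ⊥ ∧ ∃ θ : F, U = Φ.A.eigenspace θ} := hW.1.2 ▸ Set.mem_range_self i
  apply h4.1
  rw [← h3 i, h, LinearMap.range_zero]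

theorem theta_ne {i j : ℕ} (hi : i ≤ d) (hj : j ≤ d) (h : i ≠ j) : Φ.theta i ≠ Φ.theta j := by
  obtain ⟨W, hW, -, -, h3⟩ := Φ.exists_ordering
  intro he
  have h1 := Φ.range_E ⟨i, by omega⟩
  have h2 := Φ.range_E ⟨j, by omega⟩
  rw [h3] at h1 h2
  simp only [he] at h1
  exact h (by simpa using hW.1.1 (h1.trans h2.symm))

/-- Since `theta` is defined by choice, this uniqueness is what identifies the eigenvalues of the
relatives. -/
theorem theta_eq_of_range {i : Fin (d + 1)} {μ : F}
    (h : LinearMap.range (Φ.E i) = Φ.A.eigenspace μ) : Φ.theta i = μ := by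
  obtain ⟨v, hv⟩ : ∃ v, Φ.E i v ≠ 0 := by
    by_contra! hcon
    exact Φ.E_ne_zero i (LinearMap.ext hcon)
  have h1 : Φ.E i v ∈ Φ.A.eigenspace (Φ.theta i) := Φ.range_E i ▸ LinearMap.mem_range_self _ v
  have h2 : Φ.E i v ∈ Φ.A.eigenspace μ := h ▸ LinearMap.mem_range_self _ v
  rw [Module.End.mem_eigenspace_iff] at h1 h2
  exact smul_left_injective F hv (h1.symm.trans h2)

theorem theta_ddown {i : ℕ} (hi : i ≤ d) : Φ.ddown.theta i = Φ.theta (d - i) := by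
  have h := Φ.range_E (Fin.rev ⟨i, by omega⟩)
  have h2 := Φ.ddown.theta_eq_of_range (i := ⟨i, by omega⟩) h
  simp only [Fin.val_rev] at h2
  rw [h2]
  congr 1
  omega

theorem thetas_down {i : ℕ} (hi : i ≤ d) : Φ.down.thetas i = Φ.thetas (d - i) :=
  Φ.star.theta_ddown hi

theorem thetas_ne {i j : ℕ} (hi : i ≤ d) (hj : j ≤ d) (h : i ≠ j) : Φ.thetas i ≠ Φ.thetas j :=
  Φ.star.theta_ne hi hj h

/-! ### The two flags -/

/-- `E*₀V + ⋯ + E*_{n-1}V`. -/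
def low (n : ℕ) : Submodule F V := ⨅ j : Fin (d + 1), ⨅ _ : n ≤ j, LinearMap.ker (Φ.Es j)

/-- `E_mV + ⋯ + E_dV`. -/
def up (m : ℕ) : Submodule F V := ⨅ j : Fin (d + 1), ⨅ _ : (j : ℕ) < m, LinearMap.ker (Φ.E j)

variable {Φ}

theorem mem_low {n : ℕ} {v : V} : v ∈ Φ.low n ↔ ∀ j : Fin (d + 1), n ≤ j → Φ.Es j v = 0 := by
  simp [low, Submodule.mem_iInf]

theorem mem_up {m : ℕ} {v : V} : v ∈ Φ.up m ↔ ∀ j : Fin (d + 1), (j : ℕ) < m → Φ.E j v = 0 := by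
  simp [up, Submodule.mem_iInf]

variable (Φ)

theorem E_A_apply (i : Fin (d + 1)) (v : V) : Φ.E i (Φ.A v) = Φ.theta i • Φ.E i v :=
  LinearMap.congr_fun (Φ.E_mul_A i) v

theorem Es_As_apply (i : Fin (d + 1)) (v : V) : Φ.Es i (Φ.As v) = Φ.thetas i • Φ.Es i v :=
  Φ.star.E_A_apply i v

theorem low_zero : Φ.low 0 = ⊥ := by
  refine (Submodule.eq_bot_iff _).2 fun v hv => ?_
  rw [← Φ.star.sum_E_apply v]
  exact Finset.sum_eq_zero fun j _ => mem_low.1 hv j (Nat.zero_le _)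

theorem low_of_lt {n : ℕ} (h : d < n) : Φ.low n = ⊤ := by
  refine eq_top_iff.2 fun v _ => mem_low.2 fun j hj => ?_
  omega

theorem up_zero : Φ.up 0 = ⊤ :=
  eq_top_iff.2 fun v _ => mem_up.2 fun j hj => by omega

theorem low_mono {m n : ℕ} (h : m ≤ n) : Φ.low m ≤ Φ.low n :=
  fun _ hv => mem_low.2 fun j hj => mem_low.1 hv j (h.trans hj)

theorem up_anti {m n : ℕ} (h : m ≤ n) : Φ.up n ≤ Φ.up m :=
  fun _ hv => mem_up.2 fun j hj => mem_up.1 hv j (hj.trans_le h)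

variable {Φ}

theorem sub_mem_up {m : ℕ} {v : V} (hv : v ∈ Φ.up m) : Φ.A v - Φ.theta m • v ∈ Φ.up (m + 1) := by
  refine mem_up.2 fun j hj => ?_
  rw [map_sub, map_smul, E_A_apply, ← sub_smul]
  rcases Nat.lt_succ_iff_lt_or_eq.1 hj with h | h
  · rw [mem_up.1 hv j h, smul_zero]
  · rw [h, sub_self, zero_smul]

theorem sub_mem_low {n : ℕ} {v : V} (hv : v ∈ Φ.low (n + 1)) :
    Φ.As v - Φ.thetas n • v ∈ Φ.low n := by
  refine mem_low.2 fun j hj => ?_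
  rw [map_sub, map_smul, Es_As_apply, ← sub_smul]
  rcases hj.lt_or_eq with h | h
  · rw [mem_low.1 hv j h, smul_zero]
  · rw [h, sub_self, zero_smul]

theorem As_mem_low {n : ℕ} {v : V} (hv : v ∈ Φ.low n) : Φ.As v ∈ Φ.low n := by
  refine mem_low.2 fun j hj => ?_
  rw [Es_As_apply, mem_low.1 hv j hj, smul_zero]

theorem As_mem_up {m : ℕ} {v : V} (hv : v ∈ Φ.up (m + 1)) : Φ.As v ∈ Φ.up m := by
  refine mem_up.2 fun j hj => ?_
  rw [← Φ.sum_E_apply v, map_sum, map_sum]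
  refine Finset.sum_eq_zero fun k _ => ?_
  by_cases hk : (k : ℕ) < m + 1
  · rw [mem_up.1 hv k hk, map_zero, map_zero]
  · exact LinearMap.congr_fun (Φ.E_mul_As_mul_E (i := j) (j := k) (by omega)) v

theorem A_mem_low {n : ℕ} {v : V} (hv : v ∈ Φ.low n) : Φ.A v ∈ Φ.low (n + 1) := by
  refine mem_low.2 fun j hj => ?_
  rw [← Φ.star.sum_E_apply v, map_sum, map_sum]
  refine Finset.sum_eq_zero fun k _ => ?_
  by_cases hk : n ≤ (k : ℕ)
  · rw [show Φ.star.E k v = 0 from mem_low.1 hv k hk, map_zero, map_zero]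
  · exact LinearMap.congr_fun (Φ.star.E_mul_As_mul_E (i := j) (j := k) (by omega)) v

variable (Φ)

theorem eq_bot_or_top {W : Submodule F V} (h1 : ∀ v ∈ W, Φ.A v ∈ W) (h2 : ∀ v ∈ W, Φ.As v ∈ W) :
    W = ⊥ ∨ W = ⊤ := by
  by_contra! h
  exact Φ.isPair.irreducible ⟨W, Submodule.map_le_iff_le_comap.2 h1,
    Submodule.map_le_iff_le_comap.2 h2, h.1, h.2⟩

theorem exists_E_apply_ne_zero (i : Fin (d + 1)) : ∃ v, Φ.E i v ≠ 0 := by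
  by_contra! hcon
  exact Φ.E_ne_zero i (LinearMap.ext hcon)

theorem up_succ_ne_top (m : ℕ) : Φ.up (m + 1) ≠ ⊤ := by
  obtain ⟨v, hv⟩ := Φ.exists_E_apply_ne_zero 0
  intro h
  exact hv (mem_up.1 (h ▸ Submodule.mem_top : v ∈ Φ.up (m + 1)) 0 (by simp))

theorem low_ne_top {n : ℕ} (hn : n ≤ d) : Φ.low n ≠ ⊤ := by
  obtain ⟨v, hv⟩ := Φ.star.exists_E_apply_ne_zero (Fin.last d)
  intro h
  exact hv (mem_low.1 (h ▸ Submodule.mem_top : v ∈ Φ.low n) (Fin.last d) (by simpa using hn))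

/-- If `A - θ_n` raises a family and `A* - s_n` lowers it, the sum of the family is invariant under
both maps; this is the only way irreducibility enters. -/
theorem invariant_of_shift {W : ℕ → Submodule F V}
    (h1 : ∀ n, ∀ v ∈ W n, Φ.A v - Φ.theta n • v ∈ W (n + 1)) (h0 : ∀ v ∈ W 0, Φ.As v ∈ W 0)
    (s : ℕ → F) (h2 : ∀ n, ∀ v ∈ W (n + 1), Φ.As v - s n • v ∈ W n) :
    ⨆ n, W n = ⊥ ∨ ⨆ n, W n = ⊤ := by
  refine Φ.eq_bot_or_top ?_ ?_
  · refine fun v hv => Submodule.iSup_induction W (motive := fun v => Φ.A v ∈ ⨆ n, W n) hv ?_ ?_ ?_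
    · intro n v hv
      rw [← sub_add_cancel (Φ.A v) (Φ.theta n • v)]
      exact add_mem (Submodule.mem_iSup_of_mem (n + 1) (h1 n v hv))
        (Submodule.mem_iSup_of_mem n (Submodule.smul_mem _ _ hv))
    · simp
    · intro x y hx hy
      rw [map_add]
      exact add_mem hx hy
  · refine fun v hv => Submodule.iSup_induction W (motive := fun v => Φ.As v ∈ ⨆ n, W n) hv ?_ ?_ ?_
    · rintro (_ | n) v hv
      · exact Submodule.mem_iSup_of_mem 0 (h0 v hv)
      rw [← sub_add_cancel (Φ.As v) (s n • v)]
      exact add_mem (Submodule.mem_iSup_of_mem n (h2 n v hv))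
        (Submodule.mem_iSup_of_mem (n + 1) (Submodule.smul_mem _ _ hv))
    · simp
    · intro x y hx hy
      rw [map_add]
      exact add_mem hx hy

/-- The sum of all these intersections is invariant and lies in `E₁V + ⋯ + E_dV ≠ V`, the term `n =
0` being zero. Hence it vanishes. -/
theorem low_inf_up (n : ℕ) : Φ.low n ⊓ Φ.up n = ⊥ := by
  have h := Φ.invariant_of_shift (W := fun n => Φ.low n ⊓ Φ.up n)
    (fun n v hv => ⟨sub_mem (A_mem_low hv.1)
      (Submodule.smul_mem _ _ (Φ.low_mono n.le_succ hv.1)), sub_mem_up hv.2⟩)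
    (fun v hv => by
      have : v = 0 := by simpa [low_zero] using hv
      simp [this])
    Φ.thetas (fun n v hv => ⟨sub_mem_low hv.1, sub_mem (As_mem_up hv.2)
      (Submodule.smul_mem _ _ (Φ.up_anti n.le_succ hv.2))⟩)
  rcases h with h | h
  · exact eq_bot_iff.2 (h ▸ le_iSup (fun n => Φ.low n ⊓ Φ.up n) n)
  · exfalso
    refine Φ.up_succ_ne_top 0 (top_le_iff.1 (h ▸ iSup_le fun n => ?_))
    rcases n with _ | n
    · simp [low_zero]
    · exact inf_le_right.trans (Φ.up_anti (by omega))

theorem eq_zero_of_mem {n m : ℕ} (hnm : n ≤ m) {v : V} (h1 : v ∈ Φ.low n) (h2 : v ∈ Φ.up m) :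
    v = 0 := by
  have : v ∈ Φ.low n ⊓ Φ.up n := ⟨h1, Φ.up_anti hnm h2⟩
  simpa [low_inf_up] using this

theorem mem_low_one {v : V} : v ∈ Φ.low 1 ↔ v ∈ LinearMap.range (Φ.Es 0) := by
  constructor
  · intro hv
    refine ⟨v, ?_⟩
    conv_rhs => rw [← Φ.star.sum_E_apply v]
    rw [Finset.sum_eq_single 0]
    · rfl
    · intro j _ hj
      exact mem_low.1 hv j (Nat.one_le_iff_ne_zero.2 fun h => hj (Fin.ext h))
    · simp
  · rintro ⟨w, rfl⟩
    exact mem_low.2 fun j hj => LinearMap.congr_fun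
      (Φ.star.E_mul_E_ne (i := j) (j := 0) (fun h => by simp [h] at hj)) w

/-! ### Sharpness of the relatives -/

variable {Φ}

/-- `E₀` is injective on `E*₀V`, because its kernel there lies in `low 1 ⊓ up 1 = 0`; so `dim E*₀V ≤
dim E₀V = 1`. -/
theorem IsSharp.star [FiniteDimensional F V] (h : Φ.IsSharp) : Φ.star.IsSharp := by
  unfold IsSharp at h ⊢
  have hinj : Function.Injective
      ((Φ.E 0).rangeRestrict ∘ₗ (LinearMap.range (Φ.star.E 0)).subtype) := by
    refine (injective_iff_map_eq_zero _).2 fun v hv => ?_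
    have hv' : Φ.E 0 v = 0 := congrArg Subtype.val hv
    have h1 : (v : V) ∈ Φ.low 1 := Φ.mem_low_one.2 v.2
    refine Subtype.ext (Φ.eq_zero_of_mem le_rfl h1 (mem_up.2 fun j hj => ?_))
    rwa [show j = 0 from Fin.ext (by simpa using hj)]
  have hle := LinearMap.finrank_le_finrank_of_injective hinj
  rw [h] at hle
  refine le_antisymm hle (Nat.one_le_iff_ne_zero.2 fun h0 => Φ.star.E_ne_zero 0 ?_)
  rw [← LinearMap.range_eq_bot]
  exact Submodule.finrank_eq_zero.1 h0

theorem IsSharp.down (h : Φ.IsSharp) : Φ.down.IsSharp := h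

/-- `⇓ = *↓*` holds definitionally, and `↓` does not touch `E₀`. -/
theorem IsSharp.ddown [FiniteDimensional F V] (h : Φ.IsSharp) : Φ.ddown.IsSharp :=
  h.star.down.star

end TridiagonalSystem

/-! ### Newton polynomials. -/

section Newton

variable {F V : Type*} [Field F] [AddCommGroup V] [Module F V]

/-- The Newton polynomial `(X - s 0) ⋯ (X - s (i - 1))`. -/
noncomputable def newton (s : ℕ → F) (i : ℕ) : F[X] := ∏ h ∈ Finset.range i, (X - C (s h))

theorem newton_zero (s : ℕ → F) : newton s 0 = 1 := by simp [newton]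

theorem newton_succ (s : ℕ → F) (i : ℕ) : newton s (i + 1) = newton s i * (X - C (s i)) :=
  Finset.prod_range_succ _ _

theorem eval_newton (s : ℕ → F) (i : ℕ) (x : F) :
    (newton s i).eval x = ∏ h ∈ Finset.range i, (x - s h) := by
  simp [newton, eval_prod]

theorem newton_monic (s : ℕ → F) (i : ℕ) : (newton s i).Monic :=
  monic_prod_of_monic _ _ fun h _ => monic_X_sub_C (s h)

theorem natDegree_newton (s : ℕ → F) (i : ℕ) : (newton s i).natDegree = i := by
  rw [newton, natDegree_prod_of_monic _ _ fun h _ => monic_X_sub_C (s h)]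
  simp

theorem degree_sub_newton_lt {f : F[X]} {i : ℕ} (hf : f.Monic) (hi : f.natDegree = i)
    (s : ℕ → F) : (f - newton s i).degree < i := by
  have h1 := degree_eq_natDegree hf.ne_zero
  have h2 := degree_eq_natDegree (newton_monic s i).ne_zero
  have := degree_sub_lt_left (p := f) (q := newton s i) (by rw [h1, h2, natDegree_newton, hi])
    hf.ne_zero (by rw [hf.leadingCoeff, (newton_monic s i).leadingCoeff])
  rwa [h1, hi] at this

theorem aeval_newton_succ (B : Module.End F V) (s : ℕ → F) (i : ℕ) (v : V) :
    aeval B (newton s (i + 1)) v = aeval B (newton s i) (B v - s i • v) := by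
  simp [newton_succ, Module.End.mul_apply, Algebra.algebraMap_eq_smul_one]

theorem aeval_newton_succ' (B : Module.End F V) (s : ℕ → F) (i : ℕ) (v : V) :
    aeval B (newton s (i + 1)) v = B (aeval B (newton s i) v) - s i • aeval B (newton s i) v := by
  rw [newton_succ, mul_comm]
  simp [Module.End.mul_apply, Algebra.algebraMap_eq_smul_one]

end Newton

/-! ### The split sequence, its moments, and its invariance under `*`. -/

namespace TridiagonalSystem

variable {F V : Type*} [Field F] [AddCommGroup V] [Module F V] {d : ℕ}
  {Φ : TridiagonalSystem F V d}

theorem pow_A_mem_low {n : ℕ} {v : V} (hv : v ∈ Φ.low n) (k : ℕ) : (Φ.A ^ k) v ∈ Φ.low (n + k) := by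
  induction k with
  | zero => simpa using hv
  | succ k ih =>
    rw [pow_succ', Module.End.mul_apply]
    exact A_mem_low ih

theorem pow_As_mem_up {m k : ℕ} {v : V} (hv : v ∈ Φ.up (m + k)) : (Φ.As ^ k) v ∈ Φ.up m := by
  induction k generalizing m with
  | zero => simpa using hv
  | succ k ih =>
    rw [pow_succ', Module.End.mul_apply]
    exact As_mem_up (ih (by rwa [add_right_comm, add_assoc]))

theorem aeval_A_mem_low {f : F[X]} {n k : ℕ} (hf : f.degree < k) {v : V}
    (hv : v ∈ Φ.low (n + 1)) : aeval Φ.A f v ∈ Φ.low (n + k) := by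
  by_cases h0 : f = 0
  · simp [h0]
  rw [aeval_eq_sum_range' ((natDegree_lt_iff_degree_lt h0).2 hf), LinearMap.sum_apply]
  refine sum_mem fun j hj => ?_
  have hj' := Finset.mem_range.1 hj
  exact Submodule.smul_mem _ _ (Φ.low_mono (by omega) (pow_A_mem_low hv j))

theorem aeval_As_mem_up {f : F[X]} {m k : ℕ} (hf : f.degree < k) {v : V}
    (hv : v ∈ Φ.up (m + k)) : aeval Φ.As f v ∈ Φ.up (m + 1) := by
  by_cases h0 : f = 0
  · simp [h0]
  rw [aeval_eq_sum_range' ((natDegree_lt_iff_degree_lt h0).2 hf), LinearMap.sum_apply]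
  refine sum_mem fun j hj => ?_
  have hj' := Finset.mem_range.1 hj
  exact Submodule.smul_mem _ _ (pow_As_mem_up (Φ.up_anti (by omega) hv))

theorem E_aeval (j : Fin (d + 1)) (f : F[X]) (v : V) :
    Φ.E j (aeval Φ.A f v) = f.eval (Φ.theta j) • Φ.E j v := by
  induction f using Polynomial.induction_on' generalizing v with
  | add p q hp hq => simp [hp, hq, add_smul]
  | monomial n a =>
    have h : ∀ n : ℕ, Φ.E j ((Φ.A ^ n) v) = Φ.theta j ^ n • Φ.E j v := by
      intro n
      induction n with
      | zero => simp
      | succ n ih => rw [pow_succ', Module.End.mul_apply, E_A_apply, ih, smul_smul, pow_succ']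
    rw [aeval_monomial, ← Algebra.smul_def, LinearMap.smul_apply, map_smul, h, eval_monomial,
      smul_smul]

theorem aeval_E_apply (j : Fin (d + 1)) (f : F[X]) (v : V) :
    aeval Φ.A f (Φ.E j v) = f.eval (Φ.theta j) • Φ.E j v := by
  have h3 : Commute (Φ.E j) Φ.A := by
    rw [Commute, SemiconjBy, Φ.E_mul_A, Φ.A_mul_E]
  have hc : aeval Φ.A f * Φ.E j = Φ.E j * aeval Φ.A f :=
    (Algebra.commute_of_mem_adjoin_singleton_of_commute
      (aeval_mem_adjoin_singleton F Φ.A) h3).symm.eq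
  exact (LinearMap.congr_fun hc v).trans (E_aeval j f v)

theorem aeval_newton_mem {n m : ℕ} {v : V} (h1 : v ∈ Φ.low n) (h2 : v ∈ Φ.up m) (i : ℕ) :
    aeval Φ.A (newton (fun h => Φ.theta (m + h)) i) v ∈ Φ.low (n + i) ∧
      aeval Φ.A (newton (fun h => Φ.theta (m + h)) i) v ∈ Φ.up (m + i) := by
  induction i with
  | zero => simpa [newton_zero] using ⟨h1, h2⟩
  | succ i ih =>
    rw [aeval_newton_succ']
    exact ⟨sub_mem (A_mem_low ih.1) (Submodule.smul_mem _ _ (Φ.low_mono (by omega) ih.1)),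
      sub_mem_up ih.2⟩

theorem aeval_As_newton_mem_low {n i : ℕ} {v : V} (hv : v ∈ Φ.low (n + i)) :
    aeval Φ.As (newton (fun h => Φ.thetas (n + h)) i) v ∈ Φ.low n := by
  induction i generalizing v with
  | zero => simpa [newton_zero] using hv
  | succ i ih =>
    rw [aeval_newton_succ]
    exact ih (sub_mem_low (by rwa [add_assoc]))

theorem splitMap_apply (i : ℕ) (v : V) : Φ.splitMap i v =
    aeval Φ.As (newton (fun h => Φ.thetas (h + 1)) i) (aeval Φ.A (newton Φ.theta i) v) := rfl

theorem tau_mem {v : V} (hv : v ∈ LinearMap.range (Φ.Es 0)) (i : ℕ) :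
    aeval Φ.A (newton Φ.theta i) v ∈ Φ.low (i + 1) ∧ aeval Φ.A (newton Φ.theta i) v ∈ Φ.up i := by
  have := aeval_newton_mem (m := 0) (Φ.mem_low_one.2 hv) (by simp [up_zero]) i
  simpa [add_comm] using this

theorem splitMap_mem {v : V} (hv : v ∈ LinearMap.range (Φ.Es 0)) (i : ℕ) :
    Φ.splitMap i v ∈ LinearMap.range (Φ.Es 0) := by
  rw [← mem_low_one, splitMap_apply]
  have h := aeval_As_newton_mem_low (n := 1) (i := i) (by simpa [add_comm] using (tau_mem hv i).1)
  simpa [add_comm] using h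

theorem IsSharp.exists_generator [FiniteDimensional F V] (h : Φ.IsSharp) :
    ∃ e ∈ LinearMap.range (Φ.Es 0), e ≠ 0 ∧ ∀ v ∈ LinearMap.range (Φ.Es 0), ∃ c : F, v = c • e := by
  obtain ⟨e, he, h1⟩ := finrank_eq_one_iff'.1 h.star
  refine ⟨e, e.2, fun h0 => he (Subtype.ext h0), fun v hv => ?_⟩
  obtain ⟨c, hc⟩ := h1 ⟨v, hv⟩
  exact ⟨c, (congrArg Subtype.val hc).symm⟩

theorem IsSharp.isSplitValue_zeta [FiniteDimensional F V] (h : Φ.IsSharp) (i : ℕ) :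
    Φ.IsSplitValue i (Φ.zeta i) := by
  have hex : ∃ z : F, Φ.IsSplitValue i z := by
    obtain ⟨e, he, -, h1⟩ := h.exists_generator
    obtain ⟨z, hz⟩ := h1 _ (splitMap_mem he i)
    refine ⟨z, fun v hv => ?_⟩
    obtain ⟨c, rfl⟩ := h1 v hv
    rw [map_smul, hz, smul_comm]
  rw [zeta, dif_pos hex]
  exact hex.choose_spec

theorem Es_zero_apply {v : V} (hv : v ∈ LinearMap.range (Φ.Es 0)) : Φ.Es 0 v = v := by
  obtain ⟨w, rfl⟩ := hv
  exact LinearMap.congr_fun (Φ.star.E_mul_E_self 0) w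

/-- The split map ends in `E*₀V`, so `E*₀` may be applied to it; there the factors in `A*` become
the scalars `θ*₀ - θ*_{h+1}`. -/
theorem IsSharp.zeta_smul [FiniteDimensional F V] (h : Φ.IsSharp) {e : V}
    (he : e ∈ LinearMap.range (Φ.Es 0)) (i : ℕ) :
    Φ.zeta i • e = (∏ h ∈ Finset.range i, (Φ.thetas 0 - Φ.thetas (h + 1))) •
      Φ.Es 0 (aeval Φ.A (newton Φ.theta i) e) := by
  rw [← eval_newton (fun h => Φ.thetas (h + 1)) i, ← h.isSplitValue_zeta i e he,
    ← Es_zero_apply (splitMap_mem he i)]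
  exact Φ.star.E_aeval 0 _ _

/-- Insert `∑ Eⱼ = 1` after the polynomial in `A`: the split sequence depends on `V` only through
the moments `μⱼ`. -/
theorem IsSharp.zeta_eq [FiniteDimensional F V] (h : Φ.IsSharp) {e : V}
    (he : e ∈ LinearMap.range (Φ.Es 0)) (he0 : e ≠ 0) {μ : Fin (d + 1) → F}
    (hμ : ∀ j, Φ.Es 0 (Φ.E j e) = μ j • e) (i : ℕ) :
    Φ.zeta i = (∏ h ∈ Finset.range i, (Φ.thetas 0 - Φ.thetas (h + 1))) *
      ∑ j, μ j * ∏ h ∈ Finset.range i, (Φ.theta j - Φ.theta h) := by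
  apply smul_left_injective F he0
  simp only
  rw [h.zeta_smul he, mul_smul, ← Φ.sum_E_apply (aeval Φ.A (newton Φ.theta i) e), map_sum,
    Finset.sum_smul]
  congr 1
  refine Finset.sum_congr rfl fun j _ => ?_
  rw [E_aeval, map_smul, hμ, smul_smul, eval_newton, mul_comm]

/-- The split sequences of `Φ` and `Φ^⇓` are determined by the same moments. -/
theorem IsSharp.exists_moments [FiniteDimensional F V] (h : Φ.IsSharp) :
    ∃ μ : Fin (d + 1) → F, ∀ i ≤ d,
      Φ.zeta i = (∏ h ∈ Finset.range i, (Φ.thetas 0 - Φ.thetas (h + 1))) *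
        ∑ j, μ j * ∏ h ∈ Finset.range i, (Φ.theta j - Φ.theta h) ∧
      Φ.ddown.zeta i = (∏ h ∈ Finset.range i, (Φ.thetas 0 - Φ.thetas (h + 1))) *
        ∑ j, μ j * ∏ h ∈ Finset.range i, (Φ.theta j - Φ.theta (d - h)) := by
  obtain ⟨e, he, he0, h1⟩ := h.exists_generator
  choose μ hμ using fun j => h1 (Φ.Es 0 (Φ.E j e)) (LinearMap.mem_range_self _ _)
  refine ⟨μ, fun i hi => ⟨h.zeta_eq he he0 hμ i, ?_⟩⟩
  -- `E*₀` and the vector `e` are the same for `Φ^⇓`; only the labels of the `Eⱼ`, hence of the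
  -- moments, are reversed.
  rw [h.ddown.zeta_eq (e := e) he he0 (μ := fun j => μ j.rev) (fun j => hμ j.rev) i]
  congr 1
  refine Fintype.sum_equiv Fin.revPerm _ _ fun j => ?_
  simp only [Fin.revPerm_apply]
  congr 1
  refine Finset.prod_congr rfl fun h hh => ?_
  have hh' := Finset.mem_range.1 hh
  rw [theta_ddown _ (by omega : (j : ℕ) ≤ d), theta_ddown _ (by omega : h ≤ d), Fin.val_rev,
    Nat.add_sub_add_right]

theorem sub_E_zero_mem_up (v : V) : v - Φ.E 0 v ∈ Φ.up 1 := by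
  refine mem_up.2 fun j hj => ?_
  rw [show j = 0 from Fin.ext (by simpa using hj), map_sub,
    show Φ.E 0 (Φ.E 0 v) = Φ.E 0 v from LinearMap.congr_fun (Φ.E_mul_E_self 0) v, sub_self]

theorem E_zero_of_mem_up {v : V} (hv : v ∈ Φ.up 1) : Φ.E 0 v = 0 := mem_up.1 hv 0 (by simp)

theorem aeval_newton_mem_up {m : ℕ} {v : V} (h2 : v ∈ Φ.up m) (i : ℕ) :
    aeval Φ.A (newton (fun h => Φ.theta (m + h)) i) v ∈ Φ.up (m + i) :=
  (aeval_newton_mem (n := d + 1) (by simp [low_of_lt]) h2 i).2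

/-- The maps `E₀ (A* - θ*₀) ⋯ (A* - θ*_{i-1}) (A - θ₁) ⋯ (A - θᵢ)` and `E₀` are proportional. -/
theorem IsSharp.E_zero_split_apply [FiniteDimensional F V] (h : Φ.IsSharp) (i : ℕ) (v : V) :
    Φ.E 0 (aeval Φ.As (newton Φ.thetas i) (aeval Φ.A (newton (fun h => Φ.theta (h + 1)) i) v)) =
      Φ.star.zeta i • Φ.E 0 v := by
  -- The component in `up 1` is raised to `up (1 + i)` by the factors in `A`, falls back at most to
  -- `up 1` under `i` factors in `A*`, and is killed by `E₀`.
  have h1 : Φ.E 0 (aeval Φ.As (newton Φ.thetas i)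
      (aeval Φ.A (newton (fun h => Φ.theta (h + 1)) i) (v - Φ.E 0 v))) = 0 := by
    have hm := aeval_newton_mem_up (sub_E_zero_mem_up (Φ := Φ) v) i
    simp only [add_comm 1] at hm
    refine E_zero_of_mem_up (aeval_As_mem_up (m := 0) (k := i + 1) ?_ (by simpa using hm))
    rw [degree_eq_natDegree (newton_monic _ _).ne_zero, natDegree_newton]
    exact_mod_cast Nat.lt_succ_self i
  have h2 : aeval Φ.A (newton (fun h => Φ.theta (h + 1)) i) (Φ.E 0 v) =
      (∏ h ∈ Finset.range i, (Φ.theta 0 - Φ.theta (h + 1))) • Φ.E 0 v := by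
    rw [← eval_newton (fun h => Φ.theta (h + 1)) i]
    exact aeval_E_apply 0 _ v
  have h3 := h.star.zeta_smul (e := Φ.E 0 v) (LinearMap.mem_range_self _ _) i
  rw [map_sub, map_sub, map_sub, h2, sub_eq_zero] at h1
  rw [h1, map_smul, map_smul, h3]
  rfl

/-- After applying `E₀` to the split map on `E*₀V`, the roots `θ*₁, …, θ*ᵢ` may be replaced by `θ*₀,
…, θ*_{i-1}` and then `θ₀, …, θ_{i-1}` by `θ₁, …, θᵢ`. The resulting operator is evaluated by
`E_zero_split_apply`. -/
theorem IsSharp.zeta_star [FiniteDimensional F V] (h : Φ.IsSharp) (i : ℕ) :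
    Φ.star.zeta i = Φ.zeta i := by
  obtain ⟨e, he, he0, -⟩ := h.exists_generator
  have hE : Φ.E 0 e ≠ 0 := fun h0 => he0 <| Φ.eq_zero_of_mem le_rfl (Φ.mem_low_one.2 he)
    (by simpa [h0] using sub_E_zero_mem_up (Φ := Φ) e)
  apply smul_left_injective F hE
  simp only
  rw [← h.E_zero_split_apply i e, ← map_smul, ← h.isSplitValue_zeta i e he, splitMap_apply]
  set s := newton (fun h => Φ.theta (h + 1)) i with hs
  -- The difference of two monic polynomials of degree `i` has degree `< i`, so it keeps `e` in `low
  -- i`, which the factors with roots `θ*₀, …, θ*_{i-1}` annihilate.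
  have h1 : aeval Φ.As (newton Φ.thetas i) (aeval Φ.A (s - newton Φ.theta i) e) = 0 := by
    have hdeg := degree_sub_newton_lt (newton_monic (fun h => Φ.theta (h + 1)) i)
      (natDegree_newton _ i) Φ.theta
    have hm := aeval_A_mem_low (n := 0) hdeg (Φ.mem_low_one.2 he)
    have := aeval_As_newton_mem_low (n := 0) hm
    simpa [low_zero] using this
  -- The vector inside lies in `up i`, and fewer than `i` applications of `A*` cannot bring it below
  -- `up 1`.
  have h2 : Φ.E 0 (aeval Φ.As (newton (fun h => Φ.thetas (h + 1)) i - newton Φ.thetas i)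
      (aeval Φ.A (newton Φ.theta i) e)) = 0 := by
    have hdeg := degree_sub_newton_lt (newton_monic (fun h => Φ.thetas (h + 1)) i)
      (natDegree_newton _ i) Φ.thetas
    exact E_zero_of_mem_up (aeval_As_mem_up (m := 0) hdeg (by simpa using (tau_mem he i).2))
  rw [map_sub, LinearMap.sub_apply, map_sub, sub_eq_zero] at h1
  rw [map_sub, LinearMap.sub_apply, map_sub, sub_eq_zero] at h2
  rw [h1, h2]

end TridiagonalSystem

/-! ### Existence of the base. -/

namespace TridiagonalSystem

variable {F V : Type*} [Field F] [AddCommGroup V] [Module F V] {d : ℕ}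
  {Φ : TridiagonalSystem F V d}

variable (Φ) in
theorem low_one_ne_bot : Φ.low 1 ≠ ⊥ := by
  intro h
  refine Φ.star.E_ne_zero 0 (LinearMap.range_eq_bot.1 (eq_bot_iff.2 fun v hv => ?_))
  rw [← h]
  exact Φ.mem_low_one.2 hv

variable (Φ) in
/-- The components `(E*₀V + ⋯ + E*ᵢV) ∩ (EᵢV + ⋯ + E_dV)` of the split decomposition are
nonzero. -/
theorem low_succ_inf_up_ne_bot {i : ℕ} (hi : i ≤ d) : Φ.low (i + 1) ⊓ Φ.up i ≠ ⊥ := by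
  intro hbot
  rcases Nat.eq_zero_or_pos i with rfl | hpos
  · exact Φ.low_one_ne_bot (by simpa [up_zero] using hbot)
  -- Were the `i`-th component zero, the sum of the earlier ones would be invariant; but it contains
  -- `E*₀V ≠ 0` and lies in `low i ≠ V`.
  have h := Φ.invariant_of_shift (W := fun n => if n < i then Φ.low (n + 1) ⊓ Φ.up n else ⊥)
    (fun n v hv => by
      by_cases hn : n < i
      · rw [if_pos hn] at hv
        have hmem : Φ.A v - Φ.theta n • v ∈ Φ.low (n + 1 + 1) ⊓ Φ.up (n + 1) :=
          ⟨sub_mem (A_mem_low hv.1) (Submodule.smul_mem _ _ (Φ.low_mono (by omega) hv.1)),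
            sub_mem_up hv.2⟩
        by_cases hn1 : n + 1 < i
        · rwa [if_pos hn1]
        · rw [if_neg hn1, ← hbot]
          rwa [show n + 1 = i by omega] at hmem
      · rw [if_neg hn] at hv
        simp [(Submodule.mem_bot F).1 hv])
    (fun v hv => by
      rw [if_pos hpos] at hv ⊢
      exact ⟨As_mem_low hv.1, by simp [up_zero]⟩)
    (fun n => Φ.thetas (n + 1)) (fun n v hv => by
      by_cases hn : n + 1 < i
      · rw [if_pos hn] at hv
        rw [if_pos (by omega)]
        exact ⟨sub_mem_low hv.1, sub_mem (As_mem_up hv.2)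
          (Submodule.smul_mem _ _ (Φ.up_anti n.le_succ hv.2))⟩
      · rw [if_neg hn] at hv
        simp [(Submodule.mem_bot F).1 hv])
  rcases h with h | h
  · refine Φ.low_one_ne_bot (eq_bot_iff.2 (h ▸ le_trans ?_ (le_iSup _ 0)))
    simp [hpos, up_zero]
  · refine Φ.low_ne_top hi (top_le_iff.1 (h ▸ iSup_le fun n => ?_))
    split_ifs with hn
    · exact inf_le_left.trans (Φ.low_mono hn)
    · exact bot_le

/-- Each `A` climbs at most one step of the flag, so only the term of degree `r` reaches
`E*_{l+r}V`. -/
theorem Es_aeval_of_mem_low {l r : ℕ} (hr : l + r < d + 1) {f : F[X]} (hf : f.natDegree ≤ r) {v : V}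
    (hv : v ∈ Φ.low (l + 1)) :
    Φ.Es ⟨l + r, hr⟩ (aeval Φ.A f v) = f.coeff r • Φ.Es ⟨l + r, hr⟩ ((Φ.A ^ r) v) := by
  have hdeg : (f - C (f.coeff r) * X ^ r).degree < (r : WithBot ℕ) := by
    rw [degree_lt_iff_coeff_zero]
    intro m hm
    rcases hm.eq_or_lt with rfl | hlt
    · simp
    · rw [coeff_sub, coeff_C_mul_X_pow, if_neg hlt.ne', coeff_eq_zero_of_natDegree_lt (by omega),
        sub_zero]
  have h := mem_low.1 (aeval_A_mem_low hdeg hv) ⟨l + r, hr⟩ le_rfl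
  rw [map_sub, LinearMap.sub_apply, map_sub, sub_eq_zero] at h
  rw [h]
  simp [← Algebra.smul_def]

theorem mem_ddown_up {m : ℕ} {v : V} :
    v ∈ Φ.ddown.up m ↔ ∀ j : Fin (d + 1), d < j + m → Φ.E j v = 0 := by
  rw [mem_up]
  constructor
  · intro h j hj
    have := h j.rev (by rw [Fin.val_rev]; omega)
    simpa [ddown] using this
  · intro h j hj
    exact h j.rev (by rw [Fin.val_rev]; omega)

variable (Φ) in
-- Take `u ≠ 0` in the `l`-th split component. If the claim failed, `(A - θ_l)⋯(A - θ_{l+r-1})u`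
-- would lie in `low (l + r) ⊓ up (l + r) = 0`, so `u ∈ E_lV + ⋯ + E_{l+r-1}V`. By `low_inf_up` for
-- `Φ^⇓` this space meets `low (l + 1)` trivially, as `2l + r ≤ d`.
theorem exists_Es_pow_ne_zero {l r : ℕ} (hlr : 2 * l + r ≤ d) :
    ∃ v ∈ Φ.low (l + 1), Φ.Es ⟨l + r, by omega⟩ ((Φ.A ^ r) v) ≠ 0 := by
  by_contra! hcon
  obtain ⟨u, hu, hu0⟩ := Submodule.exists_mem_ne_zero_of_ne_bot
    (Φ.low_succ_inf_up_ne_bot (i := l) (by omega))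
  have hr : l + r < d + 1 := by omega
  obtain ⟨h1, h2⟩ := aeval_newton_mem hu.1 hu.2 r
  set g := newton (fun h => Φ.theta (l + h)) r with hg
  have h3 : aeval Φ.A g u ∈ Φ.low (l + r) := by
    refine mem_low.2 fun j hj => ?_
    rcases hj.eq_or_lt with h | h
    · have := Es_aeval_of_mem_low hr (natDegree_newton _ r).le hu.1 (f := g)
      rw [hcon u hu.1, smul_zero] at this
      rwa [show j = ⟨l + r, hr⟩ from Fin.ext h.symm]
    · exact mem_low.1 h1 j (by omega)
  have h4 := Φ.eq_zero_of_mem le_rfl h3 h2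
  refine hu0 (Φ.ddown.eq_zero_of_mem (n := l + 1) (m := d + 1 - (l + r)) (by omega) hu.1
    (mem_ddown_up.2 fun j hj => ?_))
  have h5 := E_aeval (Φ := Φ) j g u
  rw [h4, map_zero, hg, eval_newton] at h5
  refine (smul_eq_zero.1 h5.symm).resolve_left (Finset.prod_ne_zero_iff.2 fun h hh => ?_)
  have hh' := Finset.mem_range.1 hh
  exact sub_ne_zero.2 (Φ.theta_ne (by omega) (by omega) (by omega))

theorem hom_ext_E {f g : Module.End F V} (h : ∀ j k v, Φ.E j (f (Φ.E k v)) = Φ.E j (g (Φ.E k v))) :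
    f = g := by
  ext v
  rw [← Φ.sum_E_apply v, map_sum, map_sum]
  refine Finset.sum_congr rfl fun k _ => ?_
  rw [← Φ.sum_E_apply (f _), ← Φ.sum_E_apply (g _)]
  exact Finset.sum_congr rfl fun j _ => h j k v

variable (Φ) in
/-- There is a polynomial `z` with `A²A*A - AA*A² = z(A)A* - A*z(A)`. -/
theorem exists_commutator_polynomial : ∃ z : F[X], z.natDegree ≤ d ∧
    (∀ i < d, z.eval (Φ.theta i) - z.eval (Φ.theta (i + 1)) =
      Φ.theta i * Φ.theta (i + 1) * (Φ.theta i - Φ.theta (i + 1))) ∧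
    ∀ v, Φ.A (Φ.A (Φ.As (Φ.A v))) - Φ.A (Φ.As (Φ.A (Φ.A v))) =
      aeval Φ.A z (Φ.As v) - Φ.As (aeval Φ.A z v) := by
  have hinj : Set.InjOn Φ.theta (Finset.range (d + 1)) := by
    intro i hi j hj hij
    by_contra hne
    simp only [Finset.coe_range, Set.mem_Iio] at hi hj
    exact Φ.theta_ne (by omega) (by omega) hne hij
  -- Telescoping values that realize the prescribed consecutive differences of `z`.
  set r : ℕ → F := fun i => -∑ h ∈ Finset.range i,
    Φ.theta h * Φ.theta (h + 1) * (Φ.theta h - Φ.theta (h + 1)) with hr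
  set z := Lagrange.interpolate (Finset.range (d + 1)) Φ.theta r with hz
  have heval : ∀ i ≤ d, z.eval (Φ.theta i) = r i := fun i hi =>
    Lagrange.eval_interpolate_at_node r hinj (Finset.mem_range.2 (by omega))
  have hstep : ∀ i < d, z.eval (Φ.theta i) - z.eval (Φ.theta (i + 1)) =
      Φ.theta i * Φ.theta (i + 1) * (Φ.theta i - Φ.theta (i + 1)) := by
    intro i hi
    rw [heval i (by omega), heval (i + 1) (by omega), hr]
    simp only [Finset.sum_range_succ]
    ring
  refine ⟨z, ?_, hstep, ?_⟩
  · have h := Lagrange.degree_interpolate_lt r hinj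
    rw [Finset.card_range] at h
    by_cases h0 : z = 0
    · simp [h0]
    · exact Nat.lt_succ_iff.1 ((natDegree_lt_iff_degree_lt h0).2 h)
  · have hop : Φ.A * (Φ.A * (Φ.As * Φ.A)) - Φ.A * (Φ.As * (Φ.A * Φ.A)) =
        aeval Φ.A z * Φ.As - Φ.As * aeval Φ.A z := by
      refine hom_ext_E (Φ := Φ) fun j k v => ?_
      have hAE : Φ.A (Φ.E k v) = Φ.theta k • Φ.E k v := LinearMap.congr_fun (Φ.A_mul_E k) v
      simp only [LinearMap.sub_apply, Module.End.mul_apply, map_sub, hAE, map_smul, E_A_apply,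
        E_aeval, aeval_E_apply, smul_smul, ← sub_smul]
      -- Between `Eⱼ` and `E_k` the two sides are `θⱼθ_k(θⱼ - θ_k)` and `z(θⱼ) - z(θ_k)` times
      -- `EⱼA*E_k`, which vanishes unless `|j - k| ≤ 1`.
      by_cases hfar : (j : ℕ) + 1 < k ∨ (k : ℕ) + 1 < j
      · rw [show Φ.E j (Φ.As (Φ.E k v)) = 0 from
          LinearMap.congr_fun (Φ.E_mul_As_mul_E hfar) v, smul_zero, smul_zero]
      · congr 1
        have hj := j.2
        have hk := k.2
        obtain h | h | h : (j : ℕ) = k ∨ (k : ℕ) = j + 1 ∨ (j : ℕ) = k + 1 := by omega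
        · rw [h]
          ring
        · have := hstep j (by omega)
          rw [h]
          linear_combination -this
        · have := hstep k (by omega)
          rw [h]
          linear_combination this
    exact fun v => LinearMap.congr_fun hop v

/-- At top level, `A*` acts as `θ*_l` before the `r` climbing steps (modulo `low l`) and as
`θ*_{l+r}` after them. -/
theorem Es_commutator {z : F[X]} (hz : ∀ v, Φ.A (Φ.A (Φ.As (Φ.A v))) - Φ.A (Φ.As (Φ.A (Φ.A v))) =
      aeval Φ.A z (Φ.As v) - Φ.As (aeval Φ.A z v)) {l r : ℕ} (hr : l + r < d + 1)
    (hdeg : z.natDegree ≤ r) {v : V} (hv : v ∈ Φ.low (l + 1)) :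
    Φ.Es ⟨l + r, hr⟩ (Φ.A (Φ.A (Φ.As (Φ.A v))) - Φ.A (Φ.As (Φ.A (Φ.A v)))) =
      (z.coeff r * (Φ.thetas l - Φ.thetas (l + r))) • Φ.Es ⟨l + r, hr⟩ ((Φ.A ^ r) v) := by
  have h1 : aeval Φ.A z (Φ.As v - Φ.thetas l • v) ∈ Φ.low (l + r) := by
    rw [aeval_eq_sum_range' (Nat.lt_succ_of_le hdeg), LinearMap.sum_apply]
    refine sum_mem fun j hj => ?_
    have hj' := Finset.mem_range.1 hj
    exact Submodule.smul_mem _ _ (Φ.low_mono (by omega) (pow_A_mem_low (sub_mem_low hv) j))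
  have h2 := mem_low.1 h1 ⟨l + r, hr⟩ le_rfl
  rw [map_sub, map_smul, map_sub, map_smul, sub_eq_zero] at h2
  rw [hz, map_sub, h2, Es_As_apply, Es_aeval_of_mem_low hr hdeg hv, ← sub_smul, smul_smul, mul_comm]

/-- The left side of the relation climbs only three steps from `E*₀V`, whereas `deg z = t > 3` would
make the right side nonzero in `E*_tV`. -/
theorem natDegree_le_three {z : F[X]} (hd : z.natDegree ≤ d)
    (hz : ∀ v, Φ.A (Φ.A (Φ.As (Φ.A v))) - Φ.A (Φ.As (Φ.A (Φ.A v))) =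
      aeval Φ.A z (Φ.As v) - Φ.As (aeval Φ.A z v)) : z.natDegree ≤ 3 := by
  by_contra! hlt
  set t := z.natDegree with ht
  obtain ⟨v, hv, hne⟩ := Φ.exists_Es_pow_ne_zero (l := 0) (r := t) (by omega)
  have hr : 0 + t < d + 1 := by omega
  have h1 := Es_commutator hz hr ht.ge hv
  have h2 : Φ.A (Φ.A (Φ.As (Φ.A v))) - Φ.A (Φ.As (Φ.A (Φ.A v))) ∈ Φ.low 4 :=
    sub_mem (A_mem_low (A_mem_low (As_mem_low (A_mem_low hv))))
      (A_mem_low (As_mem_low (A_mem_low (A_mem_low hv))))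
  rw [mem_low.1 h2 _ (by simp; omega)] at h1
  refine (smul_ne_zero (mul_ne_zero ?_ (sub_ne_zero.2 ?_)) hne) h1.symm
  · rw [ht, coeff_natDegree]
    exact leadingCoeff_ne_zero.2 fun h0 => by simp [h0] at ht; omega
  · exact Φ.thetas_ne (by omega) (by omega) (by omega)

theorem thetas_sub_of_le {z : F[X]} (hdeg : z.natDegree ≤ 3)
    (hz : ∀ v, Φ.A (Φ.A (Φ.As (Φ.A v))) - Φ.A (Φ.As (Φ.A (Φ.A v))) =
      aeval Φ.A z (Φ.As v) - Φ.As (aeval Φ.A z v)) {l : ℕ} (hl : 2 * l + 3 ≤ d) :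
    Φ.thetas (l + 1) - Φ.thetas (l + 2) = z.coeff 3 * (Φ.thetas l - Φ.thetas (l + 3)) := by
  obtain ⟨v, hv, hne⟩ := Φ.exists_Es_pow_ne_zero (l := l) (r := 3) hl
  have hr : l + 3 < d + 1 := by omega
  have h1 := Es_commutator hz hr hdeg hv
  have hA3 : (Φ.A ^ 3) v = Φ.A (Φ.A (Φ.A v)) := rfl
  have h2 : Φ.Es ⟨l + 3, hr⟩ (Φ.A (Φ.A (Φ.As (Φ.A v)))) =
      Φ.thetas (l + 1) • Φ.Es ⟨l + 3, hr⟩ ((Φ.A ^ 3) v) := by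
    have := mem_low.1 (A_mem_low (A_mem_low (sub_mem_low (A_mem_low hv)))) ⟨l + 3, hr⟩ le_rfl
    simpa [hA3, sub_eq_zero] using this
  have h3 : Φ.Es ⟨l + 3, hr⟩ (Φ.A (Φ.As (Φ.A (Φ.A v)))) =
      Φ.thetas (l + 2) • Φ.Es ⟨l + 3, hr⟩ ((Φ.A ^ 3) v) := by
    have := mem_low.1 (A_mem_low (sub_mem_low (A_mem_low (A_mem_low hv)))) ⟨l + 3, hr⟩ le_rfl
    simpa [hA3, sub_eq_zero] using this
  rw [map_sub, h2, h3, ← sub_smul] at h1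
  exact smul_left_injective F hne h1

/-- Comparing components three steps up gives the lower half of the range; the upper half follows
from `Φ^↓`, which satisfies the same relation. -/
theorem thetas_sub {z : F[X]} (hdeg : z.natDegree ≤ 3)
    (hz : ∀ v, Φ.A (Φ.A (Φ.As (Φ.A v))) - Φ.A (Φ.As (Φ.A (Φ.A v))) =
      aeval Φ.A z (Φ.As v) - Φ.As (aeval Φ.A z v)) {l : ℕ} (hl : l + 3 ≤ d) :
    Φ.thetas (l + 1) - Φ.thetas (l + 2) = z.coeff 3 * (Φ.thetas l - Φ.thetas (l + 3)) := by
  by_cases h : 2 * l + 3 ≤ d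
  · exact thetas_sub_of_le hdeg hz h
  · have h1 := thetas_sub_of_le (Φ := Φ.down) hdeg hz (l := d - l - 3) (by omega)
    rw [thetas_down _ (by omega), thetas_down _ (by omega), thetas_down _ (by omega),
      thetas_down _ (by omega), show d - (d - l - 3 + 1) = l + 2 by omega,
      show d - (d - l - 3 + 2) = l + 1 by omega, show d - (d - l - 3) = l + 3 by omega,
      show d - (d - l - 3 + 3) = l by omega] at h1
    linear_combination -h1

variable (Φ) in
/-- The eigenvalue and dual eigenvalue sequences satisfy a common linear recurrence. -/
theorem exists_isBase : ∃ β : F, Φ.IsBase β := by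
  by_cases hd : 3 ≤ d
  swap
  · exact ⟨1, by simp [IsBase, hd]⟩
  obtain ⟨z, hzd, hstep, hz⟩ := Φ.exists_commutator_polynomial
  have hdeg := natDegree_le_three hzd hz
  have hs := fun l (hl : l + 3 ≤ d) => thetas_sub hdeg hz hl
  have h0 : z.coeff 3 ≠ 0 := by
    intro h0
    have := hs 0 (by omega)
    rw [h0, zero_mul, sub_eq_zero] at this
    exact Φ.thetas_ne (by omega) (by omega) (by omega) this
  have heval : ∀ x, z.eval x = z.coeff 0 + z.coeff 1 * x + z.coeff 2 * x ^ 2 + z.coeff 3 * x ^ 3 := by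
    intro x
    rw [eval_eq_sum_range' (Nat.lt_succ_of_le hdeg)]
    simp [Finset.sum_range_succ]
  -- Dividing the difference equation of the cubic `z` by `θᵢ - θ_{i+1}` gives a quadratic relation.
  -- Subtracting consecutive ones and dividing by `θᵢ - θ_{i+2}` gives a linear one, whose
  -- differences are the recurrence.
  have hquad : ∀ i < d, z.coeff 3 * (Φ.theta i ^ 2 + Φ.theta i * Φ.theta (i + 1) +
      Φ.theta (i + 1) ^ 2) + z.coeff 2 * (Φ.theta i + Φ.theta (i + 1)) + z.coeff 1 =
      Φ.theta i * Φ.theta (i + 1) := by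
    intro i hi
    have h1 := hstep i hi
    rw [heval, heval] at h1
    apply mul_right_cancel₀ (sub_ne_zero.2 (Φ.theta_ne (by omega) (by omega) i.succ_ne_self.symm :
      Φ.theta i ≠ Φ.theta (i + 1)))
    linear_combination h1
  have hlin : ∀ i, i + 2 ≤ d → z.coeff 3 * (Φ.theta i + Φ.theta (i + 1) + Φ.theta (i + 2)) +
      z.coeff 2 = Φ.theta (i + 1) := by
    intro i hi
    have h1 := hquad i (by omega)
    have h2 := hquad (i + 1) (by omega)
    apply mul_right_cancel₀ (sub_ne_zero.2 (Φ.theta_ne (by omega) (by omega) (by omega) :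
      Φ.theta i ≠ Φ.theta (i + 2)))
    linear_combination h1 - h2
  refine ⟨(z.coeff 3)⁻¹ - 1, ?_⟩
  rw [IsBase, if_pos hd]
  intro i h2 hi
  obtain ⟨l, rfl⟩ : ∃ l, i = l + 2 := ⟨i - 2, by omega⟩
  rw [Nat.add_sub_cancel, show l + 2 - 1 = l + 1 by omega, sub_add_cancel,
    div_eq_iff (sub_ne_zero.2 (Φ.theta_ne (by omega) (by omega) (by omega))),
    div_eq_iff (sub_ne_zero.2 (Φ.thetas_ne (by omega) (by omega) (by omega))),
    eq_inv_mul_iff_mul_eq₀ h0, eq_inv_mul_iff_mul_eq₀ h0]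
  refine ⟨?_, (hs l (by omega)).symm⟩
  linear_combination hlin l (by omega) - hlin (l + 1) (by omega)

end TridiagonalSystem

/-! ### Types and closed forms of the eigenvalue sequences. -/

section Types

variable {F : Type*} [Field F] {β : F} {d : ℕ}

theorem tdType_eq_I_iff : tdType β d = .I ↔ β ≠ 2 ∧ β ≠ -2 := by
  unfold tdType
  split_ifs <;> first | (simp_all; done) | (simp_all; tauto)

theorem of_tdType_eq_II (h : tdType β d = .II) : β = 2 ∧ (2 : F) ≠ 0 := by
  unfold tdType at h
  split_ifs at h with h1 h2 h3
  exact ⟨h3, Ring.two_ne_zero h2⟩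

theorem of_tdType_eq_IIIplus (h : tdType β d = .IIIplus) : β = -2 ∧ (2 : F) ≠ 0 ∧ Even d := by
  unfold tdType at h
  split_ifs at h with h1 h2 h3 h4
  exact ⟨by tauto, Ring.two_ne_zero h2, h4⟩

theorem of_tdType_eq_IIIminus (h : tdType β d = .IIIminus) : β = -2 ∧ (2 : F) ≠ 0 ∧ ¬ Even d := by
  unfold tdType at h
  split_ifs at h with h1 h2 h3 h4
  exact ⟨by tauto, Ring.two_ne_zero h2, h4⟩

theorem of_tdType_eq_IV (h : tdType β d = .IV) : β = 0 ∧ (2 : F) = 0 := by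
  unfold tdType at h
  split_ifs at h with h1 h2
  have h2' : (2 : F) = 0 := by
    have := ringChar.Nat.cast_ringChar (R := F)
    rw [not_not.1 h2] at this
    exact_mod_cast this
  have h3 : β = 2 ∨ β = -2 := by tauto
  refine ⟨?_, h2'⟩
  rcases h3 with h3 | h3 <;> simp [h3, h2']

theorem eq_of_recurrence {K : Type*} [Ring K] {f g : ℕ → K} {b : K} {d : ℕ}
    (hf : ∀ i, i + 3 ≤ d → f i - f (i + 3) = b * (f (i + 1) - f (i + 2)))
    (hg : ∀ i, i + 3 ≤ d → g i - g (i + 3) = b * (g (i + 1) - g (i + 2)))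
    (h0 : f 0 = g 0) (h1 : f 1 = g 1) (h2 : f 2 = g 2) {i : ℕ} (hi : i ≤ d) : f i = g i := by
  induction i using Nat.strong_induction_on with
  | _ i ih =>
    match i with
    | 0 => exact h0
    | 1 => exact h1
    | 2 => exact h2
    | i + 3 =>
      have e1 := hf i hi
      rw [ih i (by omega) (by omega), ih (i + 1) (by omega) (by omega),
        ih (i + 2) (by omega) (by omega), ← hg i hi] at e1
      exact sub_right_injective e1

theorem zpow_two_mul_sub {K : Type*} [Field K] {q : K} (hq : q ≠ 0) (i d : ℕ) :
    q ^ (2 * (i : ℤ) - d) = (q ^ d)⁻¹ * (q ^ 2) ^ i := by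
  rw [zpow_sub₀ hq, ← pow_mul, div_eq_mul_inv, mul_comm]
  norm_cast

theorem zpow_sub_two_mul {K : Type*} [Field K] {q : K} (hq : q ≠ 0) (i d : ℕ) :
    q ^ ((d : ℤ) - 2 * i) = q ^ d * ((q ^ 2)⁻¹) ^ i := by
  rw [zpow_sub₀ hq, inv_pow, ← pow_mul, div_eq_mul_inv]
  norm_cast

theorem exists_q {K : Type*} [Field K] [IsAlgClosed K] (b : K) :
    ∃ q : K, q ≠ 0 ∧ q ^ 2 + (q⁻¹) ^ 2 = b := by
  obtain ⟨x, hx⟩ := IsAlgClosed.exists_root (C 1 * X ^ 2 + C (-b) * X + C 1 : K[X])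
    (by rw [degree_quadratic one_ne_zero]; decide)
  simp only [IsRoot.def, eval_add, eval_mul, eval_C, eval_pow, eval_X] at hx
  obtain ⟨q, hq⟩ := IsAlgClosed.exists_pow_nat_eq x (n := 2) two_pos
  have hx0 : x ≠ 0 := by
    rintro rfl
    simp at hx
  have hq0 : q ≠ 0 := by
    rintro rfl
    exact hx0 (by simpa using hq.symm)
  refine ⟨q, hq0, ?_⟩
  rw [inv_pow, hq]
  field_simp
  linear_combination hx

theorem sq_sq_ne_one {K : Type*} [Field K] {q b : K} (h : q ^ 2 + (q⁻¹) ^ 2 = b)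
    (h2 : b ≠ 2) (h3 : b ≠ -2) : (q ^ 2) ^ 2 ≠ 1 := by
  intro h4
  have h6 : (q ^ 2 - 1) * (q ^ 2 + 1) = 0 := by linear_combination h4
  rcases mul_eq_zero.1 h6 with h5 | h5
  · apply h2
    rw [← h, inv_pow, sub_eq_zero.1 h5]
    norm_num
  · apply h3
    rw [← h, inv_pow, eq_neg_of_add_eq_zero_left h5]
    norm_num

/-- The characteristic polynomial is `(1 - x)(x² - bx + 1)`, with roots `1`, `q²`, `q⁻²`, distinct
because `b ≠ ±2`. If `d < 2`, the values of `f` beyond `d` are fitted as well, harmlessly. -/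
theorem exists_scalars_of_recurrence_I {K : Type*} [Field K] {q b : K} (hq : q ≠ 0)
    (h : q ^ 2 + (q⁻¹) ^ 2 = b) (h2 : b ≠ 2) (h3 : b ≠ -2) {f : ℕ → K} {d : ℕ}
    (hf : ∀ i, i + 3 ≤ d → f i - f (i + 3) = (b + 1) * (f (i + 1) - f (i + 2))) :
    ∃ x y z : K, ∀ i ≤ d, f i = x + y * q ^ (2 * (i : ℤ) - d) + z * q ^ ((d : ℤ) - 2 * i) := by
  have h4 := sq_sq_ne_one h h2 h3
  set Q := q ^ 2 with hQ
  have hQ0 : Q ≠ 0 := pow_ne_zero 2 hq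
  have hd : q ^ d ≠ 0 := pow_ne_zero d hq
  have h5 : Q ^ 2 - 1 ≠ 0 := sub_ne_zero.2 h4
  have h6 : Q - 1 ≠ 0 := fun h6 => h5 (by linear_combination (Q + 1) * h6)
  rw [inv_pow] at h
  -- `B` and `D` are the coefficients of `Qⁱ` and `Q⁻ⁱ`, found by eliminating one of them between
  -- the first two differences of `f`.
  set B := (f 2 - f 1 - (f 1 - f 0) / Q) * Q / ((Q - 1) * (Q ^ 2 - 1)) with hB
  set D := (f 2 - f 1 - (f 1 - f 0) * Q) * Q ^ 2 / ((Q - 1) * (Q ^ 2 - 1)) with hD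
  refine ⟨f 0 - B - D, B * q ^ d, D * (q ^ d)⁻¹, fun i hi => ?_⟩
  rw [zpow_two_mul_sub hq, zpow_sub_two_mul hq]
  have hcomb : ∀ i, f 0 - B - D + B * q ^ d * ((q ^ d)⁻¹ * Q ^ i) +
      D * (q ^ d)⁻¹ * (q ^ d * Q⁻¹ ^ i) = f 0 - B - D + B * Q ^ i + D * Q⁻¹ ^ i := by
    intro i
    field_simp
  rw [hcomb]
  refine eq_of_recurrence (g := fun i => f 0 - B - D + B * Q ^ i + D * Q⁻¹ ^ i) hf ?_ ?_ ?_ ?_ hi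
  · intro i _
    rw [← h]
    simp only [pow_succ, pow_zero, inv_pow]
    field_simp
    ring
  · simp only [pow_zero]
    ring
  · simp only [hB, hD]
    field_simp
    ring
  · simp only [hB, hD]
    field_simp
    ring

/-- Here `1` is a triple characteristic root and the closed form is a quadratic fitted to `f 0, f 1,
f 2`. -/
theorem exists_scalars_of_recurrence_II {f : ℕ → F} (h2 : (2 : F) ≠ 0)
    (hf : ∀ i, i + 3 ≤ d → f i - f (i + 3) = (2 + 1) * (f (i + 1) - f (i + 2))) :
    ∃ a b c : F, ∀ i ≤ d, f i = a + b * (i - d / 2) + c * i * (d - i) := by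
  set c := -(f 2 - 2 * f 1 + f 0) / 2 with hc
  set b := f 1 - f 0 - c * (d - 1) with hb
  refine ⟨f 0 + b * d / 2, b, c, fun i hi => eq_of_recurrence
    (g := fun i : ℕ => f 0 + b * d / 2 + b * (i - d / 2) + c * i * (d - i)) hf ?_ ?_ ?_ ?_ hi⟩
  · intro i _
    push_cast
    ring
  · simp
    ring
  · simp only [hb]
    push_cast
    field_simp
    ring
  · simp only [hb, hc]
    push_cast
    field_simp
    ring

/-- Here `-1` is a double characteristic root, whence the alternating linear term. -/
theorem exists_scalars_of_recurrence_III {f : ℕ → F} (h2 : (2 : F) ≠ 0)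
    (hf : ∀ i, i + 3 ≤ d → f i - f (i + 3) = (-2 + 1) * (f (i + 1) - f (i + 2))) :
    ∃ a b c : F, ∀ i ≤ d, f i = if Even i then a + b + c * (i - d / 2)
      else a - b - c * (i - d / 2) := by
  set c := (f 2 - f 0) / 2 with hc
  set a := (f 0 + f 1 + c) / 2 with ha
  set b := f 0 - a + c * d / 2 with hb
  refine ⟨a, b, c, fun i hi => eq_of_recurrence
    (g := fun i : ℕ => if Even i then a + b + c * (i - d / 2) else a - b - c * (i - d / 2))
      hf ?_ ?_ ?_ ?_ hi⟩
  · intro i _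
    by_cases he : Even i
    · simp only [he, Nat.not_even_one, Nat.even_add, not_true_eq_false, if_true, if_false,
        show ¬ Even 3 by decide, even_two, iff_false]
      push_cast
      ring
    · simp only [he, Nat.not_even_one, Nat.even_add, if_true, if_false,
        show ¬ Even 3 by decide, even_two, iff_true]
      push_cast
      ring
  · simp [hb]
    field_simp
    ring
  · simp [hb, ha]
    field_simp
    ring
  · simp [hb, ha, hc]
    field_simp
    ring

end Types

namespace TridiagonalSystem

variable {F V : Type*} [Field F] [AddCommGroup V] [Module F V] {d : ℕ}
  {Φ : TridiagonalSystem F V d} {β : F}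

theorem IsBase.recurrence (h : Φ.IsBase β) {i : ℕ} (hi : i + 3 ≤ d) :
    Φ.theta i - Φ.theta (i + 3) = (β + 1) * (Φ.theta (i + 1) - Φ.theta (i + 2)) ∧
      Φ.thetas i - Φ.thetas (i + 3) = (β + 1) * (Φ.thetas (i + 1) - Φ.thetas (i + 2)) := by
  rw [IsBase, if_pos (by omega)] at h
  have := h (i + 2) (by omega) (by omega)
  rwa [Nat.add_sub_cancel, show i + 2 - 1 = i + 1 by omega,
    div_eq_iff (sub_ne_zero.2 (Φ.theta_ne (by omega) (by omega) (by omega))),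
    div_eq_iff (sub_ne_zero.2 (Φ.thetas_ne (by omega) (by omega) (by omega)))] at this

/-- A zero base is allowed only for `d ≥ 3`; for `d ≥ 4`, adding two consecutive recurrences with `β
= 0` gives `θ₀ = θ₄`. -/
theorem IsBase.diameter_of_eq_zero (h : Φ.IsBase β) (hβ : β = 0) : d = 3 := by
  have h3 : 3 ≤ d := by
    by_contra h3
    rw [IsBase, if_neg h3] at h
    exact h hβ
  by_contra hne
  have e1 := (h.recurrence (i := 0) (by omega)).1
  have e2 := (h.recurrence (i := 1) (by omega)).1
  subst hβ
  simp only [zero_add, Nat.reduceAdd] at e1 e2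
  refine Φ.theta_ne (i := 0) (j := 4) (by omega) (by omega) (by omega) ?_
  linear_combination e1 + e2

/-- The eigenvalue sequences have the closed form attached to the type. -/
theorem IsBase.exists_isScalars (h : Φ.IsBase β) :
    ∃ e : TDScalars (AlgebraicClosure F), Φ.IsScalars β e := by
  have hr := fun i (hi : i + 3 ≤ d) => (h.recurrence hi).1
  have hrs := fun i (hi : i + 3 ≤ d) => (h.recurrence hi).2
  have hm2 : algebraMap F (AlgebraicClosure F) 2 = 2 := map_ofNat _ 2
  have inj := FaithfulSMul.algebraMap_injective F (AlgebraicClosure F)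
  cases ht : tdType β d
  · obtain ⟨h2, h3⟩ := tdType_eq_I_iff.1 ht
    obtain ⟨q, hq, hqb⟩ := exists_q (algebraMap F (AlgebraicClosure F) β)
    have h2' : algebraMap F (AlgebraicClosure F) β ≠ 2 := fun h' => h2 (inj (h'.trans hm2.symm))
    have h3' : algebraMap F (AlgebraicClosure F) β ≠ -2 := fun h' => h3 (inj (by rw [h', map_neg, hm2]))
    obtain ⟨a, b, c, h4⟩ := exists_scalars_of_recurrence_I hq hqb h2' h3' (f := Φ.thetaBar) (d := d)
      fun i hi => by simpa [thetaBar] using congrArg (algebraMap F (AlgebraicClosure F)) (hr i hi)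
    obtain ⟨a', b', c', h5⟩ := exists_scalars_of_recurrence_I hq hqb h2' h3' (f := Φ.thetasBar)
      (d := d)
      fun i hi => by simpa [thetasBar] using congrArg (algebraMap F (AlgebraicClosure F)) (hrs i hi)
    refine ⟨⟨q, a, b, c, a', b', c'⟩, ?_⟩
    simp only [IsScalars, ht]
    exact ⟨hq, hqb, fun i hi => ⟨h4 i hi, h5 i hi⟩⟩
  · obtain ⟨rfl, h2⟩ := of_tdType_eq_II ht
    obtain ⟨a, b, c, h4⟩ := exists_scalars_of_recurrence_II h2 hr
    obtain ⟨a', b', c', h5⟩ := exists_scalars_of_recurrence_II h2 hrs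
    refine ⟨⟨0, algebraMap _ _ a, algebraMap _ _ b, algebraMap _ _ c, algebraMap _ _ a',
      algebraMap _ _ b', algebraMap _ _ c'⟩, ?_⟩
    simp only [IsScalars, ht]
    exact ⟨by simp [TDScalars.IsRational], fun i hi => ⟨by simp [thetaBar, h4 i hi, hm2],
      by simp [thetasBar, h5 i hi, hm2]⟩⟩
  · obtain ⟨rfl, h2, -⟩ := of_tdType_eq_IIIplus ht
    obtain ⟨a, b, c, h4⟩ := exists_scalars_of_recurrence_III h2 hr
    obtain ⟨a', b', c', h5⟩ := exists_scalars_of_recurrence_III h2 hrs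
    refine ⟨⟨0, algebraMap _ _ a, algebraMap _ _ b, algebraMap _ _ c, algebraMap _ _ a',
      algebraMap _ _ b', algebraMap _ _ c'⟩, ?_⟩
    simp only [IsScalars, ht]
    exact ⟨by simp [TDScalars.IsRational], fun i hi => ⟨by
      rw [thetaBar, h4 i hi]
      split_ifs <;> simp [hm2], by
      rw [thetasBar, h5 i hi]
      split_ifs <;> simp [hm2]⟩⟩
  · obtain ⟨rfl, h2, -⟩ := of_tdType_eq_IIIminus ht
    obtain ⟨a, b, c, h4⟩ := exists_scalars_of_recurrence_III h2 hr
    obtain ⟨a', b', c', h5⟩ := exists_scalars_of_recurrence_III h2 hrs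
    refine ⟨⟨0, algebraMap _ _ a, algebraMap _ _ b, algebraMap _ _ c, algebraMap _ _ a',
      algebraMap _ _ b', algebraMap _ _ c'⟩, ?_⟩
    simp only [IsScalars, ht]
    exact ⟨by simp [TDScalars.IsRational], fun i hi => ⟨by
      rw [thetaBar, h4 i hi]
      split_ifs <;> simp [hm2], by
      rw [thetasBar, h5 i hi]
      split_ifs <;> simp [hm2]⟩⟩
  · obtain ⟨hβ, h2⟩ := of_tdType_eq_IV ht
    obtain rfl := h.diameter_of_eq_zero hβ
    have e1 := hr 0 le_rfl
    have e2 := hrs 0 le_rfl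
    subst hβ
    simp only [zero_add, one_mul] at e1 e2
    refine ⟨⟨0, Φ.thetaBar 0, Φ.thetaBar 3, Φ.thetaBar 2 - Φ.thetaBar 0, Φ.thetasBar 0,
      Φ.thetasBar 3, Φ.thetasBar 2 - Φ.thetasBar 0⟩, ?_⟩
    simp only [IsScalars, ht]
    refine ⟨trivial, by simp [TDScalars.IsRational, thetaBar, thetasBar, ← map_sub],
      ⟨trivial, ?_, by ring, trivial⟩, trivial, ?_, by ring, trivial⟩
    · simp only [thetaBar, ← map_sub, ← map_add]
      congr 1
      linear_combination e1 + h2 * (Φ.theta 1 - Φ.theta 2)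
    · simp only [thetasBar, ← map_sub, ← map_add]
      congr 1
      linear_combination e2 + h2 * (Φ.thetas 1 - Φ.thetas 2)

end TridiagonalSystem

/-! ### Newton interpolation from a table of divided differences. -/

section DividedDifferences

variable {R : Type*} [CommRing R]

/-- Newton interpolation: `D j i` is the divided difference at the nodes `x j, …, x (j + i)`. -/
theorem sum_dividedDifference {D : ℕ → ℕ → R} {x : ℕ → R} {d : ℕ}
    (h : ∀ j i, j + i + 1 ≤ d → D j (i + 1) * (x (j + i + 1) - x j) = D (j + 1) i - D j i)
    (n j : ℕ) (hn : j + n ≤ d) :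
    ∑ i ∈ Finset.range (n + 1), D j i * ∏ h ∈ Finset.range i, (x (j + n) - x (j + h)) =
      D (j + n) 0 := by
  induction n generalizing j with
  | zero => simp
  | succ n ih =>
    have h1 := ih (j + 1) (by omega)
    rw [show j + 1 + n = j + (n + 1) by omega] at h1
    rw [← h1, Finset.sum_range_succ']
    set y := x (j + (n + 1)) with hy
    set π : ℕ → R := fun i => ∏ h ∈ Finset.range i, (y - x (j + 1 + h)) with hπ
    -- The expansion from node `j + 1` becomes the one from node `j` plus a telescoping sum whose
    -- last term vanishes, as `y` is itself a node.
    have hterm : ∀ i ∈ Finset.range (n + 1), D (j + 1) i * π i =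
        (D j i * π i - D j (i + 1) * π (i + 1)) +
          D j (i + 1) * ∏ h ∈ Finset.range (i + 1), (y - x (j + h)) := by
      intro i hi
      have hi' := Finset.mem_range.1 hi
      have e1 := h j i (by omega)
      rw [Finset.prod_range_succ', add_zero, hπ]
      simp only [Finset.prod_range_succ]
      have e2 : ∏ h ∈ Finset.range i, (y - x (j + (h + 1))) =
          ∏ h ∈ Finset.range i, (y - x (j + 1 + h)) :=
        Finset.prod_congr rfl fun h _ => by rw [add_assoc, add_comm 1]
      rw [e2, show j + 1 + i = j + i + 1 by omega]
      linear_combination (-∏ h ∈ Finset.range i, (y - x (j + 1 + h))) * e1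
    have hend : π (n + 1) = 0 := by
      refine Finset.prod_eq_zero (Finset.self_mem_range_succ n) ?_
      rw [hy, show j + 1 + n = j + (n + 1) by omega, sub_self]
    rw [Finset.sum_congr rfl hterm, Finset.sum_add_distrib, Finset.sum_range_sub', hend]
    simp [hπ]
    ring

theorem sum_dividedDifference_zero {D : ℕ → ℕ → R} {x : ℕ → R} {d : ℕ}
    (h : ∀ j i, j + i + 1 ≤ d → D j (i + 1) * (x (j + i + 1) - x j) = D (j + 1) i - D j i)
    {m : ℕ} (hm : m ≤ d) :
    ∑ i ∈ Finset.range (d + 1), D 0 i * ∏ h ∈ Finset.range i, (x m - x h) = D m 0 := by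
  have h1 := sum_dividedDifference h m 0 (by omega)
  simp only [zero_add] at h1
  rw [← h1]
  symm
  refine Finset.sum_subset (Finset.range_mono (by omega)) fun i _ hi => ?_
  have hi' : m < i := by simpa using hi
  rw [Finset.prod_eq_zero (Finset.mem_range.2 hi') (sub_self _), mul_zero]

/-- Divided differences do not depend on the order of the nodes, so the reflected table satisfies
the same recurrence for the reversed nodes. -/
theorem sum_dividedDifference_rev {D : ℕ → ℕ → R} {x : ℕ → R} {d : ℕ}
    (h : ∀ j i, j + i + 1 ≤ d → D j (i + 1) * (x (j + i + 1) - x j) = D (j + 1) i - D j i)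
    {m : ℕ} (hm : m ≤ d) :
    ∑ i ∈ Finset.range (d + 1), D (d - i) i * ∏ h ∈ Finset.range i, (x m - x (d - h)) =
      D m 0 := by
  have h1 := sum_dividedDifference_zero (D := fun j i => D (d - j - i) i) (x := fun j => x (d - j))
    (d := d) ?_ (m := d - m) (by omega)
  · simpa [Nat.sub_sub_self hm] using h1
  · intro j i hji
    have h2 := h (d - j - i - 1) i (by omega)
    rw [show d - j - i - 1 + i + 1 = d - j by omega, show d - j - i - 1 + 1 = d - j - i by omega]
      at h2
    simp only [← Nat.sub_sub] at h2 ⊢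
    rw [show d - j - 1 - i = d - j - i - 1 by omega]
    linear_combination -h2

end DividedDifferences

/-! ### Reversing the nodes when the coefficients factor. -/

section Reversal

variable {K : Type*} [Field K]

/-- A Newton expansion whose coefficients factor has the same shape with respect to the reversed
nodes. -/
theorem newton_sum_rev {d : ℕ} {θ f w : ℕ → K} {r r' : ℕ → K[X]} {ε : ℕ → ℕ → K}
    (hw : ∀ i, 1 ≤ i → i ≤ d → w i ≠ 0) (hε : ∀ i, ε 0 i = 1) (hε' : ∀ i ≤ d, ε (d - i) i = 1)
    (hkey : ∀ j i, j + i + 1 ≤ d → C (ε j (i + 1) * f (i + 1) * (θ (j + i + 1) - θ j)) =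
      C (w (i + 1)) * (C (ε (j + 1) i) * r' (d - j) - C (ε j i) * r (j + i + 1)))
    {m : ℕ} (hm : m ≤ d) :
    ∑ i ∈ Finset.range (d + 1), C ((∏ h ∈ Finset.range i, f (h + 1)) *
        ∏ h ∈ Finset.range i, (θ m - θ h)) * ∏ s ∈ Finset.Icc (i + 1) d, (C (w s) * r s) =
      ∑ i ∈ Finset.range (d + 1), C ((∏ h ∈ Finset.range i, f (h + 1)) *
        ∏ h ∈ Finset.range i, (θ m - θ (d - h))) *
          ∏ s ∈ Finset.Icc (i + 1) d, (C (w s) * r' s) := by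
  set φ : ℕ → K := fun i => ∏ h ∈ Finset.range i, f (h + 1) with hφ
  -- The weight ratio is `1` on both edges `j = 0` and `j = d - i`, so the table `D` carries the two
  -- given coefficient sequences there.
  set ρ : ℕ → ℕ → K := fun j i => φ i * ∏ s ∈ Finset.range j, (w (i + s + 1) / w (d - s)) with hρ
  set D : ℕ → ℕ → K[X] := fun j i => C (ε j i * ρ j i) *
    (∏ s ∈ Finset.Icc (j + i + 1) d, (C (w s) * r s)) *
      ∏ s ∈ Finset.Icc (d - j + 1) d, (C (w s) * r' s) with hD
  have hρ1 : ∀ j i, j + i + 1 ≤ d → ρ (j + 1) i * w (d - j) = ρ j i * w (j + i + 1) := by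
    intro j i hji
    simp only [hρ]
    rw [Finset.prod_range_succ, show i + j + 1 = j + i + 1 by omega]
    have := hw (d - j) (by omega) (by omega)
    field_simp
  have hρ2 : ∀ j i, j + i + 1 ≤ d → ρ j (i + 1) * w (i + 1) = f (i + 1) * (ρ j i * w (j + i + 1)) := by
    intro j i hji
    have e1 : (∏ s ∈ Finset.range j, w (i + 1 + s + 1)) * w (i + 1) =
        (∏ s ∈ Finset.range j, w (i + s + 1)) * w (j + i + 1) := by
      rw [show j + i + 1 = i + j + 1 by omega,
        ← Finset.prod_range_succ (fun s => w (i + s + 1)), Finset.prod_range_succ']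
      rw [add_zero]
      congr 1
      exact Finset.prod_congr rfl fun s _ => by congr 1; omega
    simp only [hρ, Finset.prod_div_distrib, hφ, Finset.prod_range_succ]
    linear_combination (∏ h ∈ Finset.range i, f (h + 1)) * f (i + 1) *
      (∏ s ∈ Finset.range j, w (d - s))⁻¹ * e1
  have hrec : ∀ j i, j + i + 1 ≤ d →
      D j (i + 1) * (C (θ (j + i + 1)) - C (θ j)) = D (j + 1) i - D j i := by
    intro j i hji
    have hp : ∏ s ∈ Finset.Icc (j + i + 1) d, (C (w s) * r s) = (C (w (j + i + 1)) * r (j + i + 1)) *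
        ∏ s ∈ Finset.Icc (j + (i + 1) + 1) d, (C (w s) * r s) := by
      rw [← Finset.insert_Icc_add_one_left_eq_Icc hji, Finset.prod_insert (by simp)]
      rfl
    have hp' : ∏ s ∈ Finset.Icc (d - (j + 1) + 1) d, (C (w s) * r' s) =
        (C (w (d - j)) * r' (d - j)) * ∏ s ∈ Finset.Icc (d - j + 1) d, (C (w s) * r' s) := by
      rw [show d - (j + 1) + 1 = d - j by omega,
        ← Finset.insert_Icc_add_one_left_eq_Icc (Nat.sub_le d j), Finset.prod_insert (by simp)]
    simp only [hD]
    rw [hp, hp', show j + 1 + i + 1 = j + (i + 1) + 1 by omega]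
    have e1 := congrArg (C : K → K[X]) (hρ1 j i hji)
    have e2 := congrArg (C : K → K[X]) (hρ2 j i hji)
    have e3 := hkey j i hji
    have hw1 : (C (w (i + 1)) : K[X]) ≠ 0 := C_ne_zero.2 (hw _ (by omega) (by omega))
    simp only [map_mul, map_sub] at e1 e2 e3 ⊢
    -- With the common factors removed, the recurrence of the table is `hkey` multiplied by weights.
    have e4 : C (ε j (i + 1)) * C (ρ j (i + 1)) * (C (θ (j + i + 1)) - C (θ j)) =
        C (ε (j + 1) i) * C (ρ (j + 1) i) * C (w (d - j)) * r' (d - j) -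
          C (ε j i) * C (ρ j i) * C (w (j + i + 1)) * r (j + i + 1) := by
      apply mul_left_cancel₀ hw1
      linear_combination C (ε j (i + 1)) * (C (θ (j + i + 1)) - C (θ j)) * e2 +
        C (ρ j i) * C (w (j + i + 1)) * e3 - C (w (i + 1)) * C (ε (j + 1) i) * r' (d - j) * e1
    linear_combination (∏ s ∈ Finset.Icc (j + (i + 1) + 1) d, (C (w s) * r s)) *
      (∏ s ∈ Finset.Icc (d - j + 1) d, (C (w s) * r' s)) * e4
  have h1 := sum_dividedDifference_zero (x := fun i => C (θ i)) hrec hm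
  have h2 := sum_dividedDifference_rev (x := fun i => C (θ i)) hrec hm
  have hρ0 : ∀ i, ρ 0 i = φ i := fun i => by simp [hρ]
  have hρd : ∀ i ≤ d, ρ (d - i) i = φ i := by
    intro i hi
    have e1 : ∏ s ∈ Finset.range (d - i), w (d - s) = ∏ s ∈ Finset.range (d - i), w (i + s + 1) := by
      rw [← Finset.prod_range_reflect]
      refine Finset.prod_congr rfl fun s hs => ?_
      have := Finset.mem_range.1 hs
      congr 1
      omega
    have e2 : ∏ s ∈ Finset.range (d - i), w (i + s + 1) ≠ 0 :=
      Finset.prod_ne_zero_iff.2 fun s hs => by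
        have := Finset.mem_range.1 hs
        exact hw _ (by omega) (by omega)
    simp only [hρ, Finset.prod_div_distrib]
    rw [e1, div_self e2, mul_one]
  rw [← h2] at h1
  convert h1 using 1
  · refine Finset.sum_congr rfl fun i _ => ?_
    simp only [hD, hε, hρ0, hφ, zero_add, map_mul, map_prod, map_sub]
    simp
    ring
  · refine Finset.sum_congr rfl fun i hi => ?_
    have hi' : i ≤ d := Nat.lt_succ_iff.1 (Finset.mem_range.1 hi)
    simp only [hD, hε' i hi', hρd i hi', hφ, map_mul, map_prod, map_sub,
      Nat.sub_sub_self hi', Nat.sub_add_cancel hi']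
    simp
    ring

end Reversal

/-! ### The factors `p̂ᵢ` and the identity behind the reversal. -/

section ClosedForms

variable {K : Type*} [Field K]

theorem zpow_eigenvalue {q : K} (hq : q ≠ 0) (i d : ℕ) :
    q ^ (2 * (i : ℤ) - d) = (q ^ i) ^ 2 / q ^ d := by
  rw [zpow_sub₀ hq, mul_comm 2, zpow_mul]
  norm_cast

theorem zpow_eigenvalue' {q : K} (hq : q ≠ 0) (i d : ℕ) :
    q ^ ((d : ℤ) - 2 * i) = q ^ d / (q ^ i) ^ 2 := by
  rw [zpow_sub₀ hq, mul_comm 2, zpow_mul]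
  norm_cast

theorem zpow_hatp {q : K} (hq : q ≠ 0) (i d : ℕ) :
    q ^ (2 * (i : ℤ) - 2 * d) = (q ^ i) ^ 2 / (q ^ d) ^ 2 := by
  rw [zpow_sub₀ hq, mul_comm 2, mul_comm 2, zpow_mul, zpow_mul]
  norm_cast

end ClosedForms

namespace TDScalars

variable {F : Type*} [Field F]

/-- The weight of `p̂ᵢ`. -/
noncomputable def weight (β : F) (d : ℕ) (e : TDScalars (AlgebraicClosure F)) (i : ℕ) :
    AlgebraicClosure F :=
  match tdType β d with
  | .I => (e.q ^ i - (e.q⁻¹) ^ i) ^ 2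
  | .II => (i : AlgebraicClosure F) ^ 2
  | .IIIplus | .IIIminus => if Even i then (i : AlgebraicClosure F) ^ 2 else 1
  | .IV => 1

/-- The polynomial `p̂ᵢ` divided by its weight. -/
noncomputable def hatr (β : F) (d : ℕ) (e : TDScalars (AlgebraicClosure F)) (i : ℕ) :
    (AlgebraicClosure F)[X] :=
  match tdType β d with
  | .I => C (e.b * e.bs * e.q ^ (2 * (i : ℤ) - 2 * d) +
      e.c * e.cs * e.q ^ (2 * (d : ℤ) - 2 * i)) - X
  | .II => C (e.b * e.bs / 2 + (e.b * e.cs + e.c * e.bs) * ((d : AlgebraicClosure F) - i)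
          + e.c * e.cs * ((d : AlgebraicClosure F) - i) ^ 2) - X
  | .IIIplus => 0
  | .IIIminus =>
      if Even i then C (e.c * e.cs)
      else
        C (2 * e.b * e.bs + 2 * (e.b * e.cs + e.c * e.bs) * ((i : AlgebraicClosure F) - d)
          + e.c * e.cs * ((i : AlgebraicClosure F) - d) ^ 2) - X
  | .IV => hatp β d e i

theorem hatp_eq (β : F) (d : ℕ) (e : TDScalars (AlgebraicClosure F)) (i : ℕ) :
    hatp β d e i = C (weight β d e i) * hatr β d e i := by
  cases ht : tdType β d <;> simp only [weight, hatr, hatp, ht]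
  · simp
  · split_ifs
    · rw [← C_mul, mul_comm]
    · simp
  · simp

/-- Scalars for `Φ^⇓` obtained from scalars for `Φ`. -/
noncomputable def reversed (β : F) (d : ℕ) (e : TDScalars (AlgebraicClosure F)) :
    TDScalars (AlgebraicClosure F) :=
  match tdType β d with
  | .I => e.ddown
  | .II | .IIIminus => ⟨e.q, e.a, -e.b, e.c, e.as, e.bs, e.cs⟩
  | .IIIplus => ⟨e.q, e.a, e.b, -e.c, e.as, e.bs, e.cs⟩
  | .IV => ⟨e.q, e.b, e.a, e.c, e.as, e.bs, e.cs⟩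

/-- The indicator of the nonvanishing divided differences. -/
noncomputable def parity (β : F) (d : ℕ) (j i : ℕ) : AlgebraicClosure F :=
  match tdType β d with
  | .I | .II => 1
  | .IIIplus | .IIIminus | .IV => if ¬ Even j ∧ ¬ Even i then 0 else 1

end TDScalars

namespace TridiagonalSystem

variable {F V : Type*} [Field F] [AddCommGroup V] [Module F V] {d : ℕ}
  {Φ : TridiagonalSystem F V d} {β : F} {e : TDScalars (AlgebraicClosure F)}

open TDScalars

theorem thetaBar_ne {i j : ℕ} (hi : i ≤ d) (hj : j ≤ d) (h : i ≠ j) :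
    Φ.thetaBar i ≠ Φ.thetaBar j := fun he =>
  Φ.theta_ne hi hj h (FaithfulSMul.algebraMap_injective F (AlgebraicClosure F) he)

theorem IsScalars.q_ne_zero (h : Φ.IsScalars β e) (ht : tdType β d = .I) : e.q ≠ 0 := by
  simp only [IsScalars, ht] at h
  exact h.1

theorem IsScalars.theta_I (h : Φ.IsScalars β e) (ht : tdType β d = .I) {i : ℕ} (hi : i ≤ d) :
    Φ.thetaBar i = e.a + e.b * ((e.q ^ i) ^ 2 / e.q ^ d) + e.c * (e.q ^ d / (e.q ^ i) ^ 2) ∧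
    Φ.thetasBar i = e.as + e.bs * ((e.q ^ i) ^ 2 / e.q ^ d) +
      e.cs * (e.q ^ d / (e.q ^ i) ^ 2) := by
  have hq := h.q_ne_zero ht
  simp only [IsScalars, ht] at h
  rw [← zpow_eigenvalue hq, ← zpow_eigenvalue' hq]
  exact h.2.2 i hi

theorem IsScalars.theta_II (h : Φ.IsScalars β e) (ht : tdType β d = .II) {i : ℕ} (hi : i ≤ d) :
    Φ.thetaBar i = e.a + e.b * ((i : AlgebraicClosure F) - d / 2) + e.c * i * (d - i) ∧
    Φ.thetasBar i = e.as + e.bs * ((i : AlgebraicClosure F) - d / 2) + e.cs * i * (d - i) := by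
  simp only [IsScalars, ht] at h
  exact h.2 i hi

theorem IsScalars.theta_III (h : Φ.IsScalars β e)
    (ht : tdType β d = .IIIplus ∨ tdType β d = .IIIminus) {i : ℕ} (hi : i ≤ d) :
    (Φ.thetaBar i = if Even i then e.a + e.b + e.c * ((i : AlgebraicClosure F) - d / 2)
      else e.a - e.b - e.c * ((i : AlgebraicClosure F) - d / 2)) ∧
    (Φ.thetasBar i = if Even i then e.as + e.bs + e.cs * ((i : AlgebraicClosure F) - d / 2)
      else e.as - e.bs - e.cs * ((i : AlgebraicClosure F) - d / 2)) := by
  rcases ht with ht | ht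
  · simp only [IsScalars, ht] at h
    exact h.2 i hi
  · simp only [IsScalars, ht] at h
    exact h.2 i hi

theorem IsScalars.theta_IV (h : Φ.IsScalars β e) (ht : tdType β d = .IV) :
    d = 3 ∧ (Φ.thetaBar 0 = e.a ∧ Φ.thetaBar 1 = e.b + e.c ∧
        Φ.thetaBar 2 = e.a + e.c ∧ Φ.thetaBar 3 = e.b) ∧
      (Φ.thetasBar 0 = e.as ∧ Φ.thetasBar 1 = e.bs + e.cs ∧
        Φ.thetasBar 2 = e.as + e.cs ∧ Φ.thetasBar 3 = e.bs) := by
  simp only [IsScalars, ht] at h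
  exact ⟨h.1, h.2.2⟩

theorem two_ne_zero_bar (h : (2 : F) ≠ 0) : (2 : AlgebraicClosure F) ≠ 0 := by
  intro h2
  apply h
  apply FaithfulSMul.algebraMap_injective F (AlgebraicClosure F)
  rw [map_zero, ← h2]
  exact map_ofNat _ 2

theorem two_eq_zero_bar (h : (2 : F) = 0) : (2 : AlgebraicClosure F) = 0 := by
  rw [← map_zero (algebraMap F (AlgebraicClosure F)), ← h]
  exact (map_ofNat _ 2).symm

/-- In the closed form, a vanishing weight would give `θᵢ = θ₀`. -/
theorem IsScalars.weight_ne_zero (h : Φ.IsScalars β e) {i : ℕ} (hi : 1 ≤ i) (hid : i ≤ d) :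
    e.weight β d i ≠ 0 := by
  have hne := Φ.thetaBar_ne hid (Nat.zero_le d) (by omega)
  cases ht : tdType β d
  · have hq := h.q_ne_zero ht
    simp only [weight, ht]
    intro h0
    apply hne
    rw [(h.theta_I ht hid).1, (h.theta_I ht (Nat.zero_le d)).1]
    have h1 := pow_eq_zero_iff two_ne_zero |>.1 h0
    rw [inv_pow, sub_eq_zero, ← mul_eq_one_iff_eq_inv₀ (pow_ne_zero i hq), ← sq] at h1
    rw [h1]
    simp
  · simp only [weight, ht]
    intro h0
    apply hne
    have h1 := pow_eq_zero_iff two_ne_zero |>.1 h0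
    rw [(h.theta_II ht hid).1, (h.theta_II ht (Nat.zero_le d)).1, h1]
    simp
  · simp only [weight, ht]
    split_ifs with hev
    · intro h0
      apply hne
      have h1 := pow_eq_zero_iff two_ne_zero |>.1 h0
      rw [(h.theta_III (.inl ht) hid).1, (h.theta_III (.inl ht) (Nat.zero_le d)).1, h1]
      simp [hev]
    · exact one_ne_zero
  · simp only [weight, ht]
    split_ifs with hev
    · intro h0
      apply hne
      have h1 := pow_eq_zero_iff two_ne_zero |>.1 h0
      rw [(h.theta_III (.inr ht) hid).1, (h.theta_III (.inr ht) (Nat.zero_le d)).1, h1]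
      simp [hev]
    · exact one_ne_zero
  · simp only [weight, ht]
    exact one_ne_zero

theorem parity_zero_left (i : ℕ) : parity β d 0 i = 1 := by
  cases ht : tdType β d <;> simp [parity, ht]

/-- For types III⁻ and IV the diameter is odd, so `d - i` and `i` are never both odd: no entry on
the edge of the table is suppressed. -/
theorem parity_sub (hd : tdType β d = .IV → d = 3) (ht' : tdType β d ≠ .IIIplus) {i : ℕ}
    (hi : i ≤ d) : parity β d (d - i) i = 1 := by
  have hodd : tdType β d = .IIIminus ∨ tdType β d = .IV → ¬ Even d := by
    rintro (h | h)
    · exact (of_tdType_eq_IIIminus h).2.2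
    · rw [hd h]
      decide
  cases ht : tdType β d <;> simp only [parity, ht]
  · exact absurd ht ht'
  · rw [if_neg]
    rintro ⟨h1, h2⟩
    have := hodd (.inl ht)
    rw [Nat.even_sub hi] at h1
    tauto
  · rw [if_neg]
    rintro ⟨h1, h2⟩
    have := hodd (.inr ht)
    rw [Nat.even_sub hi] at h1
    tauto

/-- The recurrence satisfied by the divided differences. -/
theorem IsScalars.hatr_sub (h : Φ.IsScalars β e) (ht' : tdType β d ≠ .IIIplus) {j i : ℕ}
    (hji : j + i + 1 ≤ d) :
    C (parity β d j (i + 1) * (Φ.thetasBar 0 - Φ.thetasBar (i + 1)) *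
        (Φ.thetaBar (j + i + 1) - Φ.thetaBar j)) =
      C (e.weight β d (i + 1)) * (C (parity β d (j + 1) i) * hatr β d (e.reversed β d) (d - j) -
        C (parity β d j i) * hatr β d e (j + i + 1)) := by
  have hjd : j ≤ d := by omega
  cases ht : tdType β d
  · have hq := h.q_ne_zero ht
    have hi := pow_ne_zero (i + 1) hq
    have hj := pow_ne_zero j hq
    have hd := pow_ne_zero d hq
    rw [(h.theta_I ht (Nat.zero_le d)).2, (h.theta_I ht (by omega : i + 1 ≤ d)).2,
      (h.theta_I ht hji).1, (h.theta_I ht hjd).1]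
    simp only [parity, weight, hatr, reversed, ht, TDScalars.ddown, zpow_hatp hq, inv_pow, map_one,
      one_mul]
    rw [sub_sub_sub_cancel_right, ← C_sub, ← C_mul, pow_sub₀ _ hq hjd, add_assoc j i 1, pow_add _ j (i + 1)]
    congr 1
    field_simp
    ring
  · have h2 := two_ne_zero_bar (of_tdType_eq_II ht).2
    rw [(h.theta_II ht (Nat.zero_le d)).2, (h.theta_II ht (by omega : i + 1 ≤ d)).2,
      (h.theta_II ht hji).1, (h.theta_II ht hjd).1]
    simp only [parity, weight, hatr, reversed, ht, map_one, one_mul]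
    rw [sub_sub_sub_cancel_right, ← C_sub, ← C_mul, Nat.cast_sub hjd]
    congr 1
    push_cast
    field_simp
    ring
  · exact absurd ht ht'
  · obtain ⟨-, h2, hd⟩ := of_tdType_eq_IIIminus ht
    have h2 := two_ne_zero_bar h2
    rw [(h.theta_III (.inr ht) (Nat.zero_le d)).2,
      (h.theta_III (.inr ht) (by omega : i + 1 ≤ d)).2,
      (h.theta_III (.inr ht) hji).1, (h.theta_III (.inr ht) hjd).1]
    simp only [parity, weight, hatr, reversed, ht, Nat.even_sub hjd, hd, false_iff, Nat.even_add,
      Nat.not_even_one, iff_false]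
    by_cases hi : Even i <;> by_cases hj : Even j <;>
      simp only [hi, hj, iff_true, iff_false, not_true_eq_false, not_false_eq_true, if_true,
        if_false, and_true, and_false, Even.zero, map_one, map_zero, one_mul, zero_mul, mul_zero,
        zero_sub, sub_zero, sub_self, sub_sub_sub_cancel_right, ← C_sub, ← C_mul, ← C_neg,
        Nat.cast_sub hjd, iff_self, and_self]
    all_goals
      congr 1
      push_cast
      field_simp
      ring
  · obtain ⟨rfl, ⟨h0, h1, h2, h3⟩, h0', h1', h2', h3'⟩ := h.theta_IV ht
    have hc := two_eq_zero_bar (of_tdType_eq_IV ht).2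
    simp only [parity, weight, hatr, reversed, hatp, ht]
    have hj : j < 3 := by omega
    have hi : i < 3 := by omega
    interval_cases j <;> interval_cases i <;> first | omega | skip
    all_goals
      simp only [zero_add, Nat.reduceAdd, Nat.reduceSub, Nat.reduceEqDiff, if_true, if_false, Even.zero,
        Nat.not_even_one, not_true_eq_false, not_false_eq_true, and_true, and_false,
        even_two, show ¬ Even 3 by decide, h0, h1, h2, h3, h0', h1', h2', h3',
        map_one, map_zero, map_mul, map_sub, map_add, and_self]
      have hc' : (2 : (AlgebraicClosure F)[X]) = 0 := by
        rw [← C_0, ← hc]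
        rfl
      grind

end TridiagonalSystem

namespace TridiagonalSystem

variable {F V : Type*} [Field F] [AddCommGroup V] [Module F V] {d : ℕ}
  {Φ : TridiagonalSystem F V d} {β : F} {e : TDScalars (AlgebraicClosure F)}

open TDScalars

theorem normalizedDrinfeld_eq (ht : tdType β d ≠ .IIIplus) :
    Φ.normalizedDrinfeld β e = ∑ i ∈ Finset.range (d + 1), C (Φ.zetaBar i) *
      ∏ j ∈ Finset.Icc (i + 1) d, e.hatp β d j := by
  cases ht' : tdType β d <;> first | exact absurd ht' ht | simp only [normalizedDrinfeld, ht']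

theorem drinfeld_eq (ht : tdType β d ≠ .IIIplus) (q : AlgebraicClosure F) :
    Φ.drinfeld β q = ∑ i ∈ Finset.range (d + 1), C (Φ.zetaBar i) *
      ∏ j ∈ Finset.Icc (i + 1) d, Φ.p β q j := by
  cases ht' : tdType β d <;> first | exact absurd ht' ht | simp only [drinfeld, ht']

/-! ### The action of `D₄` on scalars -/

theorem isRational_iff : e.IsRational ↔ (e.a ∈ (algebraMap F (AlgebraicClosure F)).range ∧
    e.b ∈ (algebraMap F (AlgebraicClosure F)).range ∧
    e.c ∈ (algebraMap F (AlgebraicClosure F)).range) ∧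
    e.as ∈ (algebraMap F (AlgebraicClosure F)).range ∧
    e.bs ∈ (algebraMap F (AlgebraicClosure F)).range ∧
    e.cs ∈ (algebraMap F (AlgebraicClosure F)).range := by
  simp only [IsRational, List.mem_cons, List.not_mem_nil, or_false, forall_eq_or_imp, forall_eq,
    and_assoc]

theorem IsScalars.star (h : Φ.IsScalars β e) : Φ.star.IsScalars β e.star := by
  have hrat : e.IsRational → e.star.IsRational := fun h => isRational_iff.2 (isRational_iff.1 h).symm
  cases ht : tdType β d <;> simp only [IsScalars, ht] at h ⊢
  · exact ⟨h.1, h.2.1, fun i hi => (h.2.2 i hi).symm⟩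
  · exact ⟨hrat h.1, fun i hi => (h.2 i hi).symm⟩
  · exact ⟨hrat h.1, fun i hi => (h.2 i hi).symm⟩
  · exact ⟨hrat h.1, fun i hi => (h.2 i hi).symm⟩
  · exact ⟨h.1, hrat h.2.1, h.2.2.symm⟩

theorem thetaBar_ddown {i : ℕ} (hi : i ≤ d) : Φ.ddown.thetaBar i = Φ.thetaBar (d - i) := by
  rw [thetaBar, theta_ddown _ hi, thetaBar]

theorem thetasBar_ddown (i : ℕ) : Φ.ddown.thetasBar i = Φ.thetasBar i := rfl

theorem IsScalars.ddown (h : Φ.IsScalars β e) : Φ.ddown.IsScalars β (e.reversed β d) := by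
  have h' := h
  cases ht : tdType β d <;> simp only [IsScalars, ht, reversed] at h ⊢
  · refine ⟨h.1, h.2.1, fun i hi => ⟨?_, (h.2.2 i hi).2⟩⟩
    rw [thetaBar_ddown hi, (h.2.2 _ (Nat.sub_le d i)).1, Nat.cast_sub hi]
    simp only [TDScalars.ddown]
    rw [show 2 * ((d : ℤ) - i) - d = d - 2 * i by ring,
      show (d : ℤ) - 2 * (d - i) = 2 * i - d by ring]
    ring
  · have h2 := two_ne_zero_bar (of_tdType_eq_II ht).2
    refine ⟨isRational_iff.2 (by simpa only [neg_mem_iff] using isRational_iff.1 h.1), fun i hi => ⟨?_, (h.2 i hi).2⟩⟩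
    rw [thetaBar_ddown hi, (h.2 _ (Nat.sub_le d i)).1, Nat.cast_sub hi]
    field_simp
    ring
  · have h2 := two_ne_zero_bar (of_tdType_eq_IIIplus ht).2.1
    refine ⟨isRational_iff.2 (by simpa only [neg_mem_iff] using isRational_iff.1 h.1), fun i hi => ⟨?_, (h.2 i hi).2⟩⟩
    rw [thetaBar_ddown hi, (h.2 _ (Nat.sub_le d i)).1, Nat.cast_sub hi]
    simp only [Nat.even_sub hi, (of_tdType_eq_IIIplus ht).2.2, true_iff]
    split_ifs
    all_goals
      field_simp
      ring
  · have h2 := two_ne_zero_bar (of_tdType_eq_IIIminus ht).2.1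
    refine ⟨isRational_iff.2 (by simpa only [neg_mem_iff] using isRational_iff.1 h.1), fun i hi => ⟨?_, (h.2 i hi).2⟩⟩
    rw [thetaBar_ddown hi, (h.2 _ (Nat.sub_le d i)).1, Nat.cast_sub hi]
    simp only [Nat.even_sub hi, (of_tdType_eq_IIIminus ht).2.2, false_iff]
    by_cases hev : Even i
    all_goals
      simp only [hev, not_true_eq_false, not_false_eq_true, if_true, if_false]
      field_simp
      ring
  · obtain ⟨rfl, hr, ⟨h0, h1, h2, h3⟩, hs⟩ := h
    refine ⟨rfl, ?_, ⟨?_, ?_, ?_, ?_⟩, hs⟩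
    · rw [isRational_iff] at hr ⊢
      tauto
    · rw [thetaBar_ddown (by omega), h3]
    · rw [thetaBar_ddown (by omega), h2]
    · rw [thetaBar_ddown (by omega), h1]
    · rw [thetaBar_ddown (by omega), h0]

/-! ### Invariance under the generators -/

theorem drinfeld_IIIplus {q : AlgebraicClosure F} (ht : tdType β d = .IIIplus) :
    Φ.drinfeld β q = ∏ i ∈ Finset.Icc 1 d, Φ.p β q i := by
  simp only [drinfeld, ht]

theorem IsSharp.normalizedDrinfeld_star [FiniteDimensional F V] (h : Φ.IsSharp)
    (e : TDScalars (AlgebraicClosure F)) :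
    Φ.star.normalizedDrinfeld β e.star = Φ.normalizedDrinfeld β e := by
  by_cases ht : tdType β d = .IIIplus
  · simp only [normalizedDrinfeld, ht]
    rw [drinfeld_IIIplus ht, drinfeld_IIIplus ht]
    refine Finset.prod_congr rfl fun i _ => ?_
    simp only [p, ht, alpha]
    have e1 : Φ.star.thetaBar = Φ.thetasBar := rfl
    have e2 : Φ.star.thetasBar = Φ.thetaBar := rfl
    rw [e1, e2, mul_comm (Φ.thetasBar 0), mul_comm (Φ.thetasBar d),
      mul_comm (Φ.thetasBar 0 - _), add_comm (Φ.thetaBar d * _)]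
  · rw [normalizedDrinfeld_eq ht, normalizedDrinfeld_eq ht]
    refine Finset.sum_congr rfl fun i _ => ?_
    rw [zetaBar, h.zeta_star, zetaBar]
    congr 1
    refine Finset.prod_congr rfl fun j _ => ?_
    cases ht : tdType β d <;> simp only [hatp, ht, TDScalars.star]
    · ring_nf
    · ring_nf
    · ring_nf
    · ring_nf

/-- For even `i`, `(θ₀ - θᵢ)(θ*₀ - θ*ᵢ) = cc*i²` is `i²/d²` times its value at `i = d`, so the
constant combines with the main term. This exhibits the two linear factors that `⇓` interchanges. -/
theorem IsScalars.p_IIIplus (h : Φ.IsScalars β e) (ht : tdType β d = .IIIplus)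
    (q : AlgebraicClosure F) {i : ℕ} (hi : 1 ≤ i) (hid : i ≤ d) :
    Φ.p β q i = if Even i then
        (C (Φ.thetaBar 0 * Φ.thetasBar 0 + Φ.thetaBar d * Φ.thetasBar d) - X) *
          C ((i : AlgebraicClosure F) ^ 2 / (d : AlgebraicClosure F) ^ 2)
      else C (Φ.thetaBar 0 * Φ.thetasBar d + Φ.thetaBar d * Φ.thetasBar 0) - X := by
  simp only [p, ht, alpha]
  split_ifs with hev
  · have hd : (d : AlgebraicClosure F) ≠ 0 := by
      have := h.weight_ne_zero (hi.trans hid) le_rfl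
      simp only [weight, ht, (of_tdType_eq_IIIplus ht).2.2, if_true] at this
      exact fun h0 => this (by rw [h0]; simp)
    have h2 := two_ne_zero_bar (of_tdType_eq_IIIplus ht).2.1
    have e1 := h.theta_III (.inl ht) (Nat.zero_le d)
    have e2 := h.theta_III (.inl ht) (le_refl d)
    have e3 := h.theta_III (.inl ht) hid
    simp only [Even.zero, hev, (of_tdType_eq_IIIplus ht).2.2, if_true] at e1 e2 e3
    rw [e1.1, e1.2, e2.1, e2.2, e3.1, e3.2]
    simp only [sub_mul, ← C_mul]
    rw [sub_add_eq_add_sub, ← C_add]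
    congr 2
    push_cast
    field_simp
    ring
  · rw [C_1, mul_one]

theorem prod_Icc_even_odd {R : Type*} [CommMonoid R] (f g : R) {d : ℕ} (hd : Even d) :
    ∏ i ∈ Finset.Icc 1 d, (if Even i then f else g) =
      ∏ i ∈ Finset.Icc 1 d, (if Even i then g else f) := by
  obtain ⟨n, rfl⟩ := hd
  induction n with
  | zero => simp
  | succ n ih =>
    rw [show n + 1 + (n + 1) = n + n + 1 + 1 by ring, Finset.prod_Icc_succ_top (by omega),
      Finset.prod_Icc_succ_top (by omega), Finset.prod_Icc_succ_top (by omega),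
      Finset.prod_Icc_succ_top (by omega), ih]
    simp [Nat.even_add_one, mul_assoc, mul_comm f g]

theorem IsScalars.normalizedDrinfeld_ddown [FiniteDimensional F V] (h : Φ.IsScalars β e)
    (hΦ : Φ.IsSharp) :
    Φ.ddown.normalizedDrinfeld β (e.reversed β d) = Φ.normalizedDrinfeld β e := by
  by_cases ht : tdType β d = .IIIplus
  · simp only [normalizedDrinfeld, ht]
    rw [drinfeld_IIIplus ht, drinfeld_IIIplus ht]
    have e0 : Φ.ddown.thetaBar 0 = Φ.thetaBar d := thetaBar_ddown (Nat.zero_le d)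
    have e1 : Φ.ddown.thetaBar d = Φ.thetaBar 0 := by rw [thetaBar_ddown le_rfl, Nat.sub_self]
    set L : (AlgebraicClosure F)[X] :=
      C (Φ.thetaBar 0 * Φ.thetasBar 0 + Φ.thetaBar d * Φ.thetasBar d) - X with hL
    set L' : (AlgebraicClosure F)[X] :=
      C (Φ.thetaBar 0 * Φ.thetasBar d + Φ.thetaBar d * Φ.thetasBar 0) - X with hL'
    set s : ℕ → (AlgebraicClosure F)[X] := fun i => if Even i then
      C ((i : AlgebraicClosure F) ^ 2 / (d : AlgebraicClosure F) ^ 2) else 1 with hs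
    have h1 : ∏ i ∈ Finset.Icc 1 d, Φ.p β e.q i =
        (∏ i ∈ Finset.Icc 1 d, if Even i then L else L') * ∏ i ∈ Finset.Icc 1 d, s i := by
      rw [← Finset.prod_mul_distrib]
      refine Finset.prod_congr rfl fun i hi => ?_
      obtain ⟨hi1, hi2⟩ := Finset.mem_Icc.1 hi
      rw [h.p_IIIplus ht _ hi1 hi2]
      simp only [hs]
      split_ifs
      · rfl
      · rw [mul_one]
    have h2 : ∏ i ∈ Finset.Icc 1 d, Φ.ddown.p β (e.reversed β d).q i =
        (∏ i ∈ Finset.Icc 1 d, if Even i then L' else L) * ∏ i ∈ Finset.Icc 1 d, s i := by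
      rw [← Finset.prod_mul_distrib]
      refine Finset.prod_congr rfl fun i hi => ?_
      obtain ⟨hi1, hi2⟩ := Finset.mem_Icc.1 hi
      rw [h.ddown.p_IIIplus ht _ hi1 hi2, e0, e1, thetasBar_ddown, thetasBar_ddown,
        add_comm (Φ.thetaBar d * Φ.thetasBar 0), add_comm (Φ.thetaBar d * Φ.thetasBar d)]
      simp only [hs]
      split_ifs
      · rfl
      · rw [mul_one]
    rw [h1, h2, prod_Icc_even_odd _ _ (of_tdType_eq_IIIplus ht).2.2]
  · rw [normalizedDrinfeld_eq ht, normalizedDrinfeld_eq ht]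
    obtain ⟨μ, hμ⟩ := hΦ.exists_moments
    have hrev := fun m (hm : m ≤ d) => newton_sum_rev (d := d) (θ := Φ.thetaBar)
      (f := fun i => Φ.thetasBar 0 - Φ.thetasBar i) (w := weight β d e) (r := hatr β d e)
      (r' := hatr β d (e.reversed β d)) (ε := parity β d)
      (fun i h1 h2 => h.weight_ne_zero h1 h2) parity_zero_left
      (fun i hi => parity_sub (fun ht4 => (h.theta_IV ht4).1) ht hi)
      (fun j i hji => h.hatr_sub ht hji) (m := m) hm
    have hweight : weight β d (e.reversed β d) = weight β d e := by
      funext i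
      cases ht' : tdType β d <;> simp only [weight, reversed, ht']
      rfl
    simp only [hatp_eq, hweight]
    -- Weighting the identity at each node `θ_m` by its moment and summing over `m` rebuilds the
    -- split sequences of `Φ` and `Φ^⇓`.
    have key : ∀ m : Fin (d + 1), C (algebraMap F (AlgebraicClosure F) (μ m)) * _ =
      C (algebraMap F (AlgebraicClosure F) (μ m)) * _ := fun m => congrArg _
        (hrev m (Nat.lt_succ_iff.1 m.2))
    have hsum := Finset.sum_congr (rfl : (Finset.univ : Finset (Fin (d + 1))) = Finset.univ)
      fun m _ => key m
    simp only [Finset.mul_sum] at hsum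
    conv_lhs at hsum => rw [Finset.sum_comm]
    conv_rhs at hsum => rw [Finset.sum_comm]
    symm
    convert hsum using 1
    · refine Finset.sum_congr rfl fun i hi => ?_
      rw [zetaBar, (hμ i (Nat.lt_succ_iff.1 (Finset.mem_range.1 hi))).1]
      simp only [← mul_assoc, ← Finset.sum_mul]
      congr 1
      simp only [← C_mul, ← map_sum C]
      congr 1
      rw [Finset.mul_sum, map_sum]
      refine Finset.sum_congr rfl fun m _ => ?_
      simp only [map_mul, map_prod, map_sub, thetaBar, thetasBar]
      ring
    · refine Finset.sum_congr rfl fun i hi => ?_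
      rw [zetaBar, (hμ i (Nat.lt_succ_iff.1 (Finset.mem_range.1 hi))).2]
      simp only [← mul_assoc, ← Finset.sum_mul]
      congr 1
      simp only [← C_mul, ← map_sum C]
      congr 1
      rw [Finset.mul_sum, map_sum]
      refine Finset.sum_congr rfl fun m _ => ?_
      simp only [map_mul, map_prod, map_sub, thetaBar, thetasBar]
      ring

end TridiagonalSystem

namespace TridiagonalSystem

variable {F V : Type*} [Field F] [AddCommGroup V] [Module F V] {d : ℕ}
  {Φ : TridiagonalSystem F V d} {β : F} {e e' : TDScalars (AlgebraicClosure F)}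

open TDScalars

/-! ### The relation between the two polynomials -/

theorem linear_comp {K : Type*} [CommRing K] (L α k u v : K) :
    ((C L - X) * C α + C k).comp (C u * X + C v) = C ((L - v) * α + k) - C (u * α) * X := by
  simp only [add_comp, mul_comp, sub_comp, C_comp, X_comp, C_add, C_mul, C_sub]
  ring

/-- `u` clears the denominator of `αᵢ`, and `v` removes the part of `θ₀θ*_d + θ_dθ*₀` that does not
belong in `p̂ᵢ`. -/
theorem IsScalars.p_comp (h : Φ.IsScalars β e) (ht' : tdType β d ≠ .IIIplus) {i : ℕ} (hi : 1 ≤ i)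
    (hid : i ≤ d) : (Φ.p β e.q i).comp (C (e.u β d) * X + C (e.v β d)) = e.hatp β d i := by
  have hw := h.weight_ne_zero (hi.trans hid) le_rfl
  cases ht : tdType β d
  · have hq := h.q_ne_zero ht
    simp only [weight, ht] at hw
    simp only [p, ht, alpha, hatp, TDScalars.u, TDScalars.v, linear_comp]
    rw [mul_div_cancel₀ _ hw, mul_sub (C _) (C _), ← C_mul]
    congr 2
    rw [(h.theta_I ht hid).1, (h.theta_I ht hid).2, (h.theta_I ht (Nat.zero_le d)).1,
      (h.theta_I ht (Nat.zero_le d)).2, (h.theta_I ht le_rfl).1, (h.theta_I ht le_rfl).2,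
      zpow_hatp hq, zpow_hatp hq]
    have hx := pow_ne_zero i hq
    have hy := pow_ne_zero d hq
    simp only [inv_pow] at hw ⊢
    rw [pow_zero]
    set x := e.q ^ i
    set y := e.q ^ d
    have hmul : ∀ L M N : AlgebraicClosure F, L = M * (y - y⁻¹) ^ 2 →
        L * ((x - x⁻¹) ^ 2 / (y - y⁻¹) ^ 2) + N = M * (x - x⁻¹) ^ 2 + N := by
      rintro L M N rfl
      rw [mul_assoc, mul_div_cancel₀ _ hw]
    -- By the choice of `v`, `θ₀θ*_d + θ_dθ*₀ - v = (bc* + cb*)(q^d - q^{-d})²`, so the denominator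
    -- cancels.
    rw [hmul _ (e.b * e.cs + e.c * e.bs)]
    · field_simp
      ring
    · field_simp
      ring
  · have h2 := two_ne_zero_bar (of_tdType_eq_II ht).2
    simp only [weight, ht] at hw
    simp only [p, ht, alpha, hatp, TDScalars.u, TDScalars.v, linear_comp]
    rw [mul_div_cancel₀ _ hw, mul_sub (C _) (C _), ← C_mul]
    congr 2
    rw [(h.theta_II ht hid).1, (h.theta_II ht hid).2, (h.theta_II ht (Nat.zero_le d)).1,
      (h.theta_II ht (Nat.zero_le d)).2, (h.theta_II ht le_rfl).1, (h.theta_II ht le_rfl).2]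
    have hd : (d : AlgebraicClosure F) ≠ 0 := fun h0 => hw (by rw [h0]; simp)
    push_cast
    field_simp
    ring
  · exact absurd ht ht'
  · obtain ⟨-, h2, hd⟩ := of_tdType_eq_IIIminus ht
    have h2 := two_ne_zero_bar h2
    simp only [p, ht, alpha, hatp, TDScalars.u, TDScalars.v, linear_comp]
    rw [(h.theta_III (.inr ht) hid).1, (h.theta_III (.inr ht) hid).2,
      (h.theta_III (.inr ht) (Nat.zero_le d)).1, (h.theta_III (.inr ht) (Nat.zero_le d)).2,
      (h.theta_III (.inr ht) le_rfl).1, (h.theta_III (.inr ht) le_rfl).2]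
    by_cases hev : Even i
    · simp only [hev, hd, Even.zero, if_true, if_false, mul_zero, C_0, zero_mul, sub_zero]
      congr 1
      push_cast
      ring
    · simp only [hev, hd, Even.zero, if_true, if_false, mul_one, C_1, one_mul]
      congr 2
      push_cast
      field_simp
      ring
  · obtain ⟨rfl, ⟨h0, h1, h2, h3⟩, h0', h1', h2', h3'⟩ := h.theta_IV ht
    have hc := two_eq_zero_bar (of_tdType_eq_IV ht).2
    have hc' : (2 : (AlgebraicClosure F)[X]) = 0 := by
      rw [← C_0, ← hc]
      rfl
    simp only [p, ht, alpha, hatp, TDScalars.u, TDScalars.v, linear_comp]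
    interval_cases i
    all_goals
      simp only [Nat.reduceEqDiff, if_true, if_false, Nat.not_even_one, even_two,
        show ¬ Even 3 by decide, h0, h1, h2, h3, h0', h1', h2', h3', C_0, C_1, C_add, C_mul, C_sub]
      grind

theorem IsScalars.normalizedDrinfeld_eq_comp (h : Φ.IsScalars β e) :
    Φ.normalizedDrinfeld β e = (Φ.drinfeld β e.q).comp (C (e.u β d) * X + C (e.v β d)) := by
  by_cases ht : tdType β d = .IIIplus
  · simp [normalizedDrinfeld, TDScalars.u, TDScalars.v, ht]
  · rw [normalizedDrinfeld_eq ht, drinfeld_eq ht, ← coe_compRingHom_apply, map_sum]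
    refine Finset.sum_congr rfl fun i _ => ?_
    rw [coe_compRingHom_apply, mul_comp, C_comp, prod_comp]
    congr 1
    refine Finset.prod_congr rfl fun j hj => ?_
    obtain ⟨hj1, hj2⟩ := Finset.mem_Icc.1 hj
    exact (h.p_comp ht (by omega) hj2).symm

/-! ### Independence of the choice of the scalars -/

theorem vandermonde_unique {K : Type*} [Field K] {Q a b c a' b' c' : K} (hQ : Q ≠ 0)
    (hQ2 : Q ^ 2 ≠ 1)
    (h : ∀ i ≤ 2, a + b * Q ^ i + c * Q⁻¹ ^ i = a' + b' * Q ^ i + c' * Q⁻¹ ^ i) :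
    b = b' ∧ c = c' := by
  have h5 : Q ^ 2 - 1 ≠ 0 := sub_ne_zero.2 hQ2
  have h6 : Q - 1 ≠ 0 := fun h6 => h5 (by linear_combination (Q + 1) * h6)
  have e0 := h 0 (by omega)
  have e1 := h 1 (by omega)
  have e2 := h 2 (by omega)
  have hQi : Q * Q⁻¹ = 1 := mul_inv_cancel₀ hQ
  have f1 : (b - b') * Q = c - c' := by
    apply mul_left_cancel₀ h6
    linear_combination Q * (e1 - e0) - (c - c') * hQi
  have f2 : (b - b') * Q ^ 2 = c - c' := by
    apply mul_left_cancel₀ h5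
    linear_combination Q ^ 2 * (e2 - e0) - (c - c') * (Q * Q⁻¹ + 1) * hQi
  have f3 : b - b' = 0 := by
    have : (b - b') * (Q * (Q - 1)) = 0 := by linear_combination f2 - f1
    exact (mul_eq_zero.1 this).resolve_right (mul_ne_zero hQ h6)
  refine ⟨sub_eq_zero.1 f3, sub_eq_zero.1 ?_⟩
  rw [← f1, f3, zero_mul]

theorem IsScalars.base_I (h : Φ.IsScalars β e) (ht : tdType β d = .I) :
    e.q ^ 2 + (e.q ^ 2)⁻¹ = algebraMap F (AlgebraicClosure F) β ∧ (e.q ^ 2) ^ 2 ≠ 1 := by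
  simp only [IsScalars, ht] at h
  obtain ⟨h2, h3⟩ := tdType_eq_I_iff.1 ht
  have inj := FaithfulSMul.algebraMap_injective F (AlgebraicClosure F)
  have hm2 : algebraMap F (AlgebraicClosure F) 2 = 2 := map_ofNat _ 2
  refine ⟨by rw [← inv_pow]; exact h.2.1, sq_sq_ne_one h.2.1 (fun h' => h2 (inj (h'.trans hm2.symm)))
    fun h' => h3 (inj (by rw [h', map_neg, hm2]))⟩

theorem IsScalars.theta_I' (h : Φ.IsScalars β e) (ht : tdType β d = .I) {i : ℕ} (hi : i ≤ d) :
    Φ.thetaBar i = e.a + e.b / e.q ^ d * (e.q ^ 2) ^ i + e.c * e.q ^ d * (e.q ^ 2)⁻¹ ^ i ∧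
    Φ.thetasBar i = e.as + e.bs / e.q ^ d * (e.q ^ 2) ^ i +
      e.cs * e.q ^ d * (e.q ^ 2)⁻¹ ^ i := by
  have hq := h.q_ne_zero ht
  rw [(h.theta_I ht hi).1, (h.theta_I ht hi).2, inv_pow, pow_right_comm]
  constructor <;> ring

/-- In terms of `q²` and the coefficients of `q^{2i}` and `q^{-2i}`, `p̂ᵢ` is visibly unchanged when
`q²` is inverted and the coefficients are exchanged. -/
theorem hatp_I (ht : tdType β d = .I) (hq : e.q ≠ 0) (i : ℕ) :
    e.hatp β d i = C ((e.q ^ 2) ^ i - 2 + (e.q ^ 2)⁻¹ ^ i) *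
      (C (e.b / e.q ^ d * (e.bs / e.q ^ d) * (e.q ^ 2) ^ i +
        e.c * e.q ^ d * (e.cs * e.q ^ d) * (e.q ^ 2)⁻¹ ^ i) - X) := by
  simp only [hatp, ht]
  have hx := pow_ne_zero i hq
  have hy := pow_ne_zero d hq
  rw [zpow_hatp hq, zpow_hatp hq, inv_pow, inv_pow, pow_right_comm e.q 2 i]
  congr 2
  · field_simp
    ring
  · congr 1
    field_simp

theorem IsScalars.hatp_unique_I (h : Φ.IsScalars β e) (h' : Φ.IsScalars β e')
    (ht : tdType β d = .I) (hd : 2 ≤ d) (i : ℕ) : e.hatp β d i = e'.hatp β d i := by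
  have hq := h.q_ne_zero ht
  have hq' := h'.q_ne_zero ht
  obtain ⟨hb, hQ⟩ := h.base_I ht
  obtain ⟨hb', -⟩ := h'.base_I ht
  have hQ0 := pow_ne_zero 2 hq
  have hQ0' := pow_ne_zero 2 hq'
  rw [hatp_I ht hq, hatp_I ht hq']
  have ht1 := fun i (hi : i ≤ 2) => (h.theta_I' ht (hi.trans hd)).1.symm.trans
    (h'.theta_I' ht (hi.trans hd)).1
  have ht2 := fun i (hi : i ≤ 2) => (h.theta_I' ht (hi.trans hd)).2.symm.trans
    (h'.theta_I' ht (hi.trans hd)).2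
  -- Both squares are roots of `x + x⁻¹ = β`.
  have hor : e'.q ^ 2 = e.q ^ 2 ∨ e'.q ^ 2 = (e.q ^ 2)⁻¹ := by
    rw [← hb'] at hb
    generalize e.q ^ 2 = Q at *
    generalize e'.q ^ 2 = Q' at *
    have : (Q' - Q) * (Q' - Q⁻¹) = 0 := by
      have e1 : Q * Q⁻¹ = 1 := mul_inv_cancel₀ hQ0
      have e2 : Q' * Q'⁻¹ = 1 := mul_inv_cancel₀ hQ0'
      linear_combination e1 - e2 - Q' * hb
    rcases mul_eq_zero.1 this with h | h
    · exact .inl (sub_eq_zero.1 h)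
    · exact .inr (sub_eq_zero.1 h)
  rcases hor with hor | hor
  · rw [hor] at ht1 ht2 ⊢
    obtain ⟨e1, e2⟩ := vandermonde_unique hQ0 hQ ht1
    obtain ⟨e3, e4⟩ := vandermonde_unique hQ0 hQ ht2
    rw [e1, e2, e3, e4]
  · rw [hor, inv_inv] at ht1 ht2 ⊢
    obtain ⟨e1, e2⟩ := vandermonde_unique hQ0 hQ fun i hi => (ht1 i hi).trans (add_right_comm _ _ _)
    obtain ⟨e3, e4⟩ := vandermonde_unique hQ0 hQ fun i hi => (ht2 i hi).trans (add_right_comm _ _ _)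
    rw [e1, e2, e3, e4, add_comm (_ * (e.q ^ 2) ^ i), sub_add_eq_add_sub, sub_add_eq_add_sub,
      add_comm ((e.q ^ 2) ^ i)]

theorem IsScalars.hatp_unique (h : Φ.IsScalars β e) (h' : Φ.IsScalars β e')
    (hI : tdType β d = .I → d ≠ 1) {i : ℕ} (hi : 1 ≤ i) (hid : i ≤ d) :
    e.hatp β d i = e'.hatp β d i := by
  cases ht : tdType β d
  · have := hI ht
    exact h.hatp_unique_I h' ht (by omega) i
  · have h2 := two_ne_zero_bar (of_tdType_eq_II ht).2
    have hw : ∀ n, 1 ≤ n → n ≤ d → (n : AlgebraicClosure F) ≠ 0 := fun n h1 h2 h0 => by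
      have := h.weight_ne_zero h1 h2
      simp only [weight, ht, h0] at this
      simp at this
    have hd := hw d (hi.trans hid) le_rfl
    have e0 := fun n (hn : n ≤ d) => (h.theta_II ht hn).1.symm.trans (h'.theta_II ht hn).1
    have e0' := fun n (hn : n ≤ d) => (h.theta_II ht hn).2.symm.trans (h'.theta_II ht hn).2
    -- For `d = 1` the scalar `c` is not determined, but `p̂ᵢ` involves it only through `c(d - i)`,
    -- which is.
    have key : ∀ a b c a' b' c' : AlgebraicClosure F,
        (∀ n : ℕ, n ≤ d → a + b * (n - d / 2) + c * n * (d - n) =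
          a' + b' * (n - d / 2) + c' * n * (d - n)) →
        b = b' ∧ c * (d - i) = c' * (d - i) := by
      intro a b c a' b' c' hn
      have f0 := hn 0 (Nat.zero_le d)
      have fd := hn d le_rfl
      have hb : b = b' := by
        apply mul_right_cancel₀ hd
        push_cast at f0
        linear_combination fd - f0
      refine ⟨hb, ?_⟩
      subst hb
      have fi := hn i hid
      push_cast at f0
      apply mul_left_cancel₀ (hw i hi hid)
      have fa : a = a' := by linear_combination f0
      subst fa
      linear_combination fi
    obtain ⟨k1, k2⟩ := key _ _ _ _ _ _ e0
    obtain ⟨k3, k4⟩ := key _ _ _ _ _ _ e0'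
    simp only [hatp, ht]
    congr 3
    rw [k1, k3]
    linear_combination e'.b * k4 + e'.bs * k2 + e.cs * (d - i) * k2 + e'.c * (d - i) * k4
  · simp only [hatp, ht]
  · obtain ⟨-, h2, hd⟩ := of_tdType_eq_IIIminus ht
    have h2 := two_ne_zero_bar h2
    have e0 := fun n (hn : n ≤ d) => (h.theta_III (.inr ht) hn).1.symm.trans
      (h'.theta_III (.inr ht) hn).1
    have e0' := fun n (hn : n ≤ d) => (h.theta_III (.inr ht) hn).2.symm.trans
      (h'.theta_III (.inr ht) hn).2
    have key : ∀ a b c a' b' c' : AlgebraicClosure F,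
        (∀ n : ℕ, n ≤ d → (if Even n then a + b + c * (n - d / 2) else a - b - c * (n - d / 2)) =
          if Even n then a' + b' + c' * (n - d / 2) else a' - b' - c' * (n - d / 2)) →
        b = b' ∧ (2 ≤ d → c = c') := by
      intro a b c a' b' c' hn
      have f0 := hn 0 (Nat.zero_le d)
      have fd := hn d le_rfl
      simp only [Even.zero, if_true, hd, if_false, Nat.cast_zero] at f0 fd
      have hb : b = b' := by
        apply mul_left_cancel₀ h2
        have hh : (d : AlgebraicClosure F) * 2⁻¹ * 2 = d := inv_mul_cancel_right₀ h2 _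
        linear_combination f0 - fd + (c - c') * hh
      refine ⟨hb, fun hd2 => ?_⟩
      have f2 := hn 2 hd2
      simp only [even_two, if_true, Nat.cast_ofNat] at f2
      apply mul_left_cancel₀ h2
      linear_combination f2 - f0
    obtain ⟨k1, k2⟩ := key _ _ _ _ _ _ e0
    obtain ⟨k3, k4⟩ := key _ _ _ _ _ _ e0'
    simp only [hatp, ht]
    by_cases hd2 : 2 ≤ d
    · rw [k1, k2 hd2, k3, k4 hd2]
    -- For `d = 1` the scalar `c` is free, but it enters `p̂₁` only with the factor `i - d = 0`.
    · obtain rfl : i = 1 := by omega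
      obtain rfl : d = 1 := by omega
      simp [k1, k3]
  · obtain ⟨-, ⟨h0, h1, h2, h3⟩, h0', h1', h2', h3'⟩ := h.theta_IV ht
    obtain ⟨-, ⟨g0, g1, g2, g3⟩, g0', g1', g2', g3'⟩ := h'.theta_IV ht
    have ea : e.a = e'.a := h0.symm.trans g0
    have eb : e.b = e'.b := h3.symm.trans g3
    have ec : e.c = e'.c := by linear_combination g2 - h2 - ea
    have ea' : e.as = e'.as := h0'.symm.trans g0'
    have eb' : e.bs = e'.bs := h3'.symm.trans g3'
    have ec' : e.cs = e'.cs := by linear_combination g2' - h2' - ea'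
    simp only [hatp, ht, ea, eb, ec, ea', eb', ec']

theorem IsScalars.normalizedDrinfeld_unique (h : Φ.IsScalars β e) (h' : Φ.IsScalars β e')
    (hI : tdType β d = .I → d ≠ 1) : Φ.normalizedDrinfeld β e = Φ.normalizedDrinfeld β e' := by
  by_cases ht : tdType β d = .IIIplus
  · simp only [normalizedDrinfeld, drinfeld, p, alpha, ht]
  · rw [normalizedDrinfeld_eq ht, normalizedDrinfeld_eq ht]
    refine Finset.sum_congr rfl fun i _ => ?_
    congr 1
    refine Finset.prod_congr rfl fun j hj => ?_
    obtain ⟨hj1, hj2⟩ := Finset.mem_Icc.1 hj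
    exact h.hatp_unique h' hI (by omega) hj2

/-! ### Invariance under `D₄` -/

/-- The relative of `Φ` under `g` is sharp, and has scalars that give it the same normalized
polynomial as the scalars `e` give to `Φ`. -/
def Transports (β : F) (g : D4) (Φ : TridiagonalSystem F V d)
    (e : TDScalars (AlgebraicClosure F)) : Prop :=
  (d4 g Φ).IsSharp ∧ ∃ e₀, (d4 g Φ).IsScalars β e₀ ∧
    (d4 g Φ).normalizedDrinfeld β e₀ = Φ.normalizedDrinfeld β e ∧
    (tdType β d = .I → e₀ = TDScalars.d4 g e)

theorem d4_of (x : D4Gen) : d4 (PresentedGroup.of x) =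
    (genPerm x : Equiv.Perm (TridiagonalSystem F V d)) :=
  PresentedGroup.toGroup.of _

theorem _root_.TDScalars.d4_of {K : Type*} (x : D4Gen) : TDScalars.d4 (PresentedGroup.of x) =
    (TDScalars.genPerm x : Equiv.Perm (TDScalars K)) :=
  PresentedGroup.toGroup.of _

theorem _root_.D4.of_mul_of (x : D4Gen) :
    (PresentedGroup.of x * PresentedGroup.of x : D4) = 1 := by
  have h : FreeGroup.of x * FreeGroup.of x ∈ D4Rels := by
    cases x <;> simp [D4Rels]
  exact PresentedGroup.one_of_mem h

theorem reversed_eq_ddown (ht : tdType β d = .I) : e.reversed β d = e.ddown := by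
  simp only [reversed, ht]

theorem IsScalars.transports_of [FiniteDimensional F V] (h : Φ.IsScalars β e) (hΦ : Φ.IsSharp)
    (x : D4Gen) : Transports β (PresentedGroup.of x) Φ e := by
  unfold Transports
  rw [d4_of, TDScalars.d4_of]
  cases x
  · exact ⟨hΦ.star, e.star, h.star, hΦ.normalizedDrinfeld_star e, fun _ => rfl⟩
  -- `↓ = *⇓*`, so its invariance is that of `*` and `⇓` combined.
  · refine ⟨hΦ.down, (e.star.reversed β d).star, h.star.ddown.star, ?_, fun ht => ?_⟩
    · exact (hΦ.star.ddown.normalizedDrinfeld_star _).trans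
        ((h.star.normalizedDrinfeld_ddown hΦ.star).trans (hΦ.normalizedDrinfeld_star e))
    · rw [reversed_eq_ddown ht]
      rfl
  · refine ⟨hΦ.ddown, e.reversed β d, h.ddown, h.normalizedDrinfeld_ddown hΦ, fun ht => ?_⟩
    rw [reversed_eq_ddown ht]
    rfl

theorem IsScalars.transports [FiniteDimensional F V] (h : Φ.IsScalars β e) (hΦ : Φ.IsSharp)
    (g : D4) : Transports β g Φ e := by
  have hg : g ∈ Subgroup.closure (Set.range (PresentedGroup.of : D4Gen → D4)) := by
    rw [PresentedGroup.closure_range_of]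
    trivial
  have hstep : ∀ (x : D4Gen) (y : D4), Transports β y Φ e →
      Transports β (PresentedGroup.of x * y) Φ e := by
    rintro x y ⟨h1, e₁, h2, h3, h4⟩
    obtain ⟨k1, e₂, k2, k3, k4⟩ := h2.transports_of h1 x
    refine ⟨by simpa using k1, e₂, by simpa using k2, by simpa using k3.trans h3, fun ht => ?_⟩
    rw [k4 ht, h4 ht, map_mul, Equiv.Perm.mul_apply]
  induction hg using Subgroup.closure_induction_left with
  | one => exact ⟨by simpa using hΦ, e, by simpa using h, by simp, by simp⟩
  | mul_left x hx y _ hy =>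
    obtain ⟨z, rfl⟩ := hx
    exact hstep z y hy
  | inv_mul_cancel x hx y _ hy =>
    obtain ⟨z, rfl⟩ := hx
    rw [inv_eq_of_mul_eq_one_left (D4.of_mul_of z)]
    exact hstep z y hy

end TridiagonalSystem

open TridiagonalSystem in
theorem mainTheorem2 {F V : Type*} [Field F] [AddCommGroup V] [Module F V]
    [FiniteDimensional F V] [Nontrivial V] {d : ℕ}
    (Φ : TridiagonalSystem F V d) (hΦ : Φ.IsSharp) :
    -- the split sequence and the base are well defined
    (∀ i ≤ d, Φ.IsSplitValue i (Φ.zeta i)) ∧ (∃ β : F, Φ.IsBase β) ∧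
    ∀ β : F, Φ.IsBase β →
      -- the scalars that enter the normalized polynomial exist
      (∃ e : TDScalars (AlgebraicClosure F), Φ.IsScalars β e) ∧
      ∀ e : TDScalars (AlgebraicClosure F), Φ.IsScalars β e →
        -- the relation between the normalized polynomial and the Drinfel'd polynomial
        Φ.normalizedDrinfeld β e =
          (Φ.drinfeld β e.q).comp
            (Polynomial.C (e.u β d) * Polynomial.X + Polynomial.C (e.v β d)) ∧
        -- for type I, transported scalars are scalars for the relative
        (tdType β d = TDType.I → ∀ g : D4,
          (TridiagonalSystem.d4 g Φ).IsScalars β (TDScalars.d4 g e)) ∧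
        -- invariance; for type I and diameter 1 the scalars of the relative are the
        -- transported ones, in all other cases they are arbitrary
        ∀ (g : D4) (e' : TDScalars (AlgebraicClosure F)),
          (TridiagonalSystem.d4 g Φ).IsScalars β e' →
          (tdType β d = TDType.I → d = 1 → e' = TDScalars.d4 g e) →
          (TridiagonalSystem.d4 g Φ).normalizedDrinfeld β e' = Φ.normalizedDrinfeld β e := by
  refine ⟨fun i _ => hΦ.isSplitValue_zeta i, Φ.exists_isBase, fun β hβ =>
    ⟨hβ.exists_isScalars, fun e h => ⟨h.normalizedDrinfeld_eq_comp, fun ht g => ?_,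
      fun g e' h' hI => ?_⟩⟩⟩
  · obtain ⟨-, e₀, h1, -, h2⟩ := h.transports hΦ g
    exact h2 ht ▸ h1
  · obtain ⟨-, e₀, h1, h2, h3⟩ := h.transports hΦ g
    rw [← h2]
    -- In the exceptional case `e'` is prescribed to be the transported system `e₀`; otherwise the
    -- polynomial does not depend on the scalars.
    by_cases hc : tdType β d = .I ∧ d = 1
    · rw [hI hc.1 hc.2, h3 hc.1]
    · exact h'.normalizedDrinfeld_unique h1 fun ht hd => hc ⟨ht, hd⟩
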